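/- Let $p\ge q\ge 1$ be integers, $\rho\in[0,1)$, and let $U$ be a symmetric positive definite real $p\times p$ matrix. Write $M(p,q)$ for the space of real $p\times q$ matrices, $P^+(q)$ for the set of symmetric positive definite real $q\times q$ matrices, $\Gamma_q(a)=\int_{P^+(q)}\det(S)^{a-(q+1)/2}e^{-\operatorname{tr}S}\prod_{i\le j}\mathrm{d}S_{ij}$ for the multivariate Gamma function, and $\mu(\mathrm{d}S)=\det(S)^{-(q+1)/2}\prod_{i\le j}\mathrm{d}S_{ij}$ on $P^+(q)$. Let $$\nu_U(\mathrm{d}x)=\frac{\Gamma_q(p/2)}{\pi^{pq/2}}\,\frac{\det(U)^{-q/2}}{\det(x^\top U^{-1}x)^{p/2}}\,\operatorname{Leb}(\mathrm{d}x)\quad\text{on } M(p,q).$$ For $T\in P^+(q)$ and $r>q-1$, let $W_q^{-1}(r,T)$ be the inverse-Wishart law on $P^+(q)$, with $\mu$-density $$S\mapsto \frac{\det(T)^{r/2}\exp(-\operatorname{tr}[TS^{-1}]/2)}{2^{rq/2}\det(S)^{r/2}\,\Gamma_q(r/2)},$$ and, for $V\in P^+(q)$, let $N_{p,q}(0,U,V)$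 be the matrix-normal law on $M(p,q)$, with Lebesgue density $$X\mapsto \frac{\exp(-\operatorname{tr}[V^{-1}X^\top U^{-1}X]/2)}{(2\pi)^{pq/2}\det(U)^{q/2}\det(V)^{p/2}}.$$ The MpCN proposal kernel $Q$ on $M(p,q)$ is defined as follows. If $\det(x^\top U^{-1}x)\neq 0$, then $Q(x,\cdot)$ is the law of $$y=\rho^{1/2}x+(1-\rho)^{1/2}w,\qquad w\mid V\sim N_{p,q}(0,U,V),\qquad V\sim W_q^{-1}(p,x^\top U^{-1}x);$$ for the remaining $x$ (a Lebesgue-null set, on which the inverse-Wishart law is undefined) put $Q(x,\cdot)=\delta_x$. Then $Q$ is a Markov kernel and, for every $x\in M(p,q)$ with $\det(x^\top U^{-1}x)\ne0$, the measure $Q(x,\cdot)$ has density $\mathsf q(x,\cdot)$ with respect to $\nu_U$, where $$\mathsf q(x,y)=(1-\rho)^{pq/2}\,c_{p,q}\,\frac{\det(x^\top U^{-1}x)^{p/2}\,\det(y^\top U^{-1}y)^{p/2}}{\det(R(x,y))^p},\qquad c_{p,q}=\frac{\Gamma_q(p)}{\Gamma_q(p/2)^2},$$ $$R(x,y)=x^\top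 U^{-1}x+y^\top U^{-1}y-\rho^{1/2}x^\top U^{-1}y-\rho^{1/2}y^\top U^{-1}x.$$ Moreover $\mathsf q(x,y)=\mathsf q(y,x)$ for all $x,y\in M(p,q)$ (where a quotient with zero denominator is read as $0$), and $Q$ is $\nu_U$-reversible: $\int_A Q(x,B)\,\nu_U(\mathrm{d}x)=\int_B Q(x,A)\,\nu_U(\mathrm{d}x)$ for all Borel sets $A,B\subseteq M(p,q)$. -/

import Mathlib

open MeasureTheory ProbabilityTheory Matrix

noncomputable section

namespace MpCN

/-- `M(p,q)`, the space of real `p × q` matrices. -/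
abbrev M (p q : ℕ) : Type := Matrix (Fin p) (Fin q) ℝ

/-! ### Lebesgue measure on `M(p,q)`: the product of the Lebesgue measures of the entries -/

instance instMeasurableSpaceM (p q : ℕ) : MeasurableSpace (M p q) :=
  inferInstanceAs (MeasurableSpace (Fin p → Fin q → ℝ))

instance instMeasureSpaceM (p q : ℕ) : MeasureSpace (M p q) where
  volume := (volume : Measure (Fin p → Fin q → ℝ))

instance instSecondCountableM (p q : ℕ) : SecondCountableTopology (M p q) :=
  inferInstanceAs (SecondCountableTopology (Fin p → Fin q → ℝ))

instance instBorelSpaceM (p q : ℕ) : BorelSpace (M p q) :=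
  inferInstanceAs (BorelSpace (Fin p → Fin q → ℝ))

instance instSigmaFiniteM (p q : ℕ) : SigmaFinite (volume : Measure (M p q)) :=
  inferInstanceAs (SigmaFinite (volume : Measure (Fin p → Fin q → ℝ)))

/-! ### Reference measures -/

/-- The symmetric matrix whose entries on and above the diagonal are given by `v`. -/
def symMatrix (q : ℕ) (v : {ij : Fin q × Fin q // ij.1 ≤ ij.2} → ℝ) : M q q :=
  Matrix.of fun i j => v ⟨(min i j, max i j), min_le_max⟩

/-- The measure `∏_{i ≤ j} dS_{ij}`, carried by the symmetric matrices. -/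
def symLeb (q : ℕ) : Measure (M q q) :=
  (volume : Measure ({ij : Fin q × Fin q // ij.1 ≤ ij.2} → ℝ)).map (symMatrix q)

/-- The set `P⁺(q)` of symmetric positive definite matrices. -/
def posDefSet (q : ℕ) : Set (M q q) := {S | S.PosDef}

/-- The multivariate Gamma function
`Γ_q(a) = ∫_{P⁺(q)} (det S)^{a-(q+1)/2} exp(-tr S) ∏_{i ≤ j} dS_{ij}`. -/
def multiGamma (q : ℕ) (a : ℝ) : ℝ :=
  ∫ S in posDefSet q, S.det ^ (a - ((q : ℝ) + 1) / 2) * Real.exp (-S.trace) ∂(symLeb q)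

/-- The measure `μ(dS) = (det S)^{-(q+1)/2} ∏_{i ≤ j} dS_{ij}` on `P⁺(q)`. -/
def muP (q : ℕ) : Measure (M q q) :=
  ((symLeb q).restrict (posDefSet q)).withDensity
    fun S => ENNReal.ofReal (S.det ^ (-((q : ℝ) + 1) / 2))

/-- The Lebesgue density of `ν_U`. -/
def nuDensity {p q : ℕ} (U : M p p) (x : M p q) : ℝ :=
  multiGamma q ((p : ℝ) / 2) / Real.pi ^ ((p : ℝ) * q / 2) *
    (U.det ^ (-(q : ℝ) / 2) / (xᵀ * U⁻¹ * x).det ^ ((p : ℝ) / 2))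

/-- The reference measure `ν_U` on `M(p,q)`. -/
def nu {p : ℕ} (q : ℕ) (U : M p p) : Measure (M p q) :=
  (volume : Measure (M p q)).withDensity fun x => ENNReal.ofReal (nuDensity U x)

/-! ### Matrix-normal and inverse-Wishart distributions -/

/-- The Lebesgue density of `N_{p,q}(m, Sg, T)`. -/
def normalDensity {p q : ℕ} (m : M p q) (Sg : M p p) (T : M q q) (X : M p q) : ℝ :=
  Real.exp (-(T⁻¹ * (X - m)ᵀ * Sg⁻¹ * (X - m)).trace / 2) /
    ((2 * Real.pi) ^ ((p : ℝ) * q / 2) * Sg.det ^ ((q : ℝ) / 2) * T.det ^ ((p : ℝ) / 2))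

/-- The matrix-normal distribution `N_{p,q}(m, Sg, T)`. -/
def matrixNormal {p q : ℕ} (m : M p q) (Sg : M p p) (T : M q q) : Measure (M p q) :=
  (volume : Measure (M p q)).withDensity fun X => ENNReal.ofReal (normalDensity m Sg T X)

/-- The density of `W_q⁻¹(r, T)` with respect to `μ`. -/
def invWishartDensity {q : ℕ} (r : ℝ) (T S : M q q) : ℝ :=
  T.det ^ (r / 2) * Real.exp (-(T * S⁻¹).trace / 2) /
    (2 ^ (r * q / 2) * S.det ^ (r / 2) * multiGamma q (r / 2))

/-- The inverse-Wishart distribution `W_q⁻¹(r, T)`. -/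
def invWishart {q : ℕ} (r : ℝ) (T : M q q) : Measure (M q q) :=
  (muP q).withDensity fun S => ENNReal.ofReal (invWishartDensity r T S)

/-! ### The MpCN proposal -/

/-- The law of `w`, where `V ∼ W_q⁻¹(p, xᵀU⁻¹x)` and, given `V`, `w ∼ N_{p,q}(0, U, V)`. -/
def noiseLaw {p q : ℕ} (U : M p p) (x : M p q) : Measure (M p q) :=
  (invWishart (p : ℝ) (xᵀ * U⁻¹ * x)).bind fun V => matrixNormal 0 U V

/-- The law of `y = ρ^{1/2} x + (1-ρ)^{1/2} w`. -/
def proposalLaw {p q : ℕ} (ρ : ℝ) (U : M p p) (x : M p q) : Measure (M p q) :=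
  (noiseLaw U x).map fun w => √ρ • x + √(1 - ρ) • w

theorem measurable_det (n : ℕ) : Measurable fun A : M n n => A.det :=
  (Continuous.matrix_det continuous_id).measurable

theorem measurable_inv (n : ℕ) : Measurable fun A : M n n => A⁻¹ := by
  have h : (fun A : M n n => A⁻¹) = fun A : M n n => (A.det)⁻¹ • A.adjugate := by
    funext A
    rw [Matrix.inv_def, Ring.inverse_eq_inv']
  rw [h]
  have h2 : Measurable fun A : M n n => A.adjugate :=
    (Continuous.matrix_adjugate continuous_id).measurable
  exact (measurable_det n).inv.smul h2

theorem measurable_gram {p q : ℕ} (U : M p p) :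
    Measurable fun x : M p q => xᵀ * U⁻¹ * x :=
  Continuous.measurable (by fun_prop)

theorem measurable_normalDensity {p q : ℕ} (U : M p p) :
    Measurable fun z : M q q × M p q => normalDensity 0 U z.1 z.2 := by
  unfold normalDensity
  have h1 : Measurable fun z : M q q × M p q => z.1⁻¹ :=
    (measurable_inv q).comp measurable_fst
  have h2 : Measurable fun z : M q q × M p q => z.1.det :=
    (measurable_det q).comp measurable_fst
  have hc : Continuous fun z : M q q × M p q =>
      (z.1 * (z.2 - 0)ᵀ * U⁻¹ * (z.2 - 0)).trace := by fun_prop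
  have h3 := hc.measurable.comp (h1.prodMk measurable_snd)
  exact (Real.measurable_exp.comp (h3.neg.div_const 2)).div
    ((h2.pow_const _).const_mul _)

theorem measurable_invWishartDensity {p q : ℕ} (r : ℝ) (U : M p p) :
    Measurable fun z : M p q × M q q => invWishartDensity r (z.1ᵀ * U⁻¹ * z.1) z.2 := by
  unfold invWishartDensity
  have h0 : Measurable fun z : M p q × M q q => z.1ᵀ * U⁻¹ * z.1 :=
    (measurable_gram U).comp measurable_fst
  have h1 : Measurable fun z : M p q × M q q => z.2⁻¹ :=
    (measurable_inv q).comp measurable_snd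
  have h2 : Measurable fun z : M p q × M q q => z.2.det :=
    (measurable_det q).comp measurable_snd
  have h4 : Measurable fun z : M p q × M q q => (z.1ᵀ * U⁻¹ * z.1).det :=
    (measurable_det q).comp h0
  have hc : Continuous fun z : M q q × M q q => (z.1 * z.2).trace := by fun_prop
  have h3 := hc.measurable.comp (h0.prodMk h1)
  exact ((h4.pow_const _).mul (Real.measurable_exp.comp (h3.neg.div_const 2))).div
    (((h2.pow_const _).const_mul _).mul_const _)

instance instSFiniteMuP (q : ℕ) : SFinite (muP q) := by
  unfold muP symLeb
  infer_instance

theorem measurable_proposalLaw {p q : ℕ} (ρ : ℝ) (U : M p p) :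
    Measurable fun x : M p q => proposalLaw ρ U x := by
  let K : Kernel (M p q) (M q q) := Kernel.withDensity (Kernel.const _ (muP q))
    fun x S => ENNReal.ofReal (invWishartDensity (p : ℝ) (xᵀ * U⁻¹ * x) S)
  let N : Kernel (M q q) (M p q) := Kernel.withDensity (Kernel.const _ volume)
    fun V X => ENNReal.ofReal (normalDensity 0 U V X)
  have : IsSFiniteKernel K :=
    Kernel.IsSFiniteKernel.withDensity _ fun _ _ => ENNReal.ofReal_ne_top
  have : IsSFiniteKernel N :=
    Kernel.IsSFiniteKernel.withDensity _ fun _ _ => ENNReal.ofReal_ne_top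
  have hK : ∀ x, K x = invWishart (p : ℝ) (xᵀ * U⁻¹ * x) := fun x =>
    Kernel.withDensity_apply _ (measurable_invWishartDensity (p : ℝ) U).ennreal_ofReal x
  have hN : ∀ V, N V = matrixNormal 0 U V := fun V =>
    Kernel.withDensity_apply _ (measurable_normalDensity U).ennreal_ofReal V
  have hg : Measurable fun z : M p q × M p q => √ρ • z.1 + √(1 - ρ) • z.2 :=
    Continuous.measurable (by fun_prop)
  have h : (fun x : M p q => proposalLaw ρ U x)
      = fun x => ((Kernel.id ×ₖ (N ∘ₖ K)).map
        fun z : M p q × M p q => √ρ • z.1 + √(1 - ρ) • z.2) x := by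
    funext x
    have hNK : (N ∘ₖ K) x = noiseLaw U x := by
      rw [Kernel.comp_apply, hK, noiseLaw]
      congr 1
      funext V
      exact hN V
    have : SFinite (noiseLaw U x) := hNK ▸ inferInstance
    rw [Kernel.map_apply _ hg, Kernel.prod_apply, Kernel.id_apply, hNK, Measure.dirac_prod,
      Measure.map_map hg measurable_prodMk_left]
    rfl
  rw [h]
  exact Kernel.measurable _

/-- The MpCN proposal kernel on `M(p,q)`. The inverse-Wishart law is not defined when `xᵀU⁻¹x` is
singular; at these `x` (a Lebesgue-null set) the proposal is, by convention, to stay at `x`. -/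
def mpcnKernel {p q : ℕ} (ρ : ℝ) (U : M p p) : Kernel (M p q) (M p q) where
  toFun x :=
    haveI := Classical.dec ((xᵀ * U⁻¹ * x).det = 0)
    if (xᵀ * U⁻¹ * x).det = 0 then Measure.dirac x else proposalLaw ρ U x
  measurable' :=
    have : DecidablePred fun x : M p q => (xᵀ * U⁻¹ * x).det = 0 := Classical.decPred _
    Measurable.ite
      (((measurable_det q).comp (measurable_gram U)) (measurableSet_singleton 0))
      Measure.measurable_dirac (measurable_proposalLaw ρ U)

/-! ### The explicit density -/

/-- `R(x,y) = xᵀU⁻¹x + yᵀU⁻¹y - ρ^{1/2} xᵀU⁻¹y - ρ^{1/2} yᵀU⁻¹x`. -/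
def R {p q : ℕ} (ρ : ℝ) (U : M p p) (x y : M p q) : M q q :=
  xᵀ * U⁻¹ * x + yᵀ * U⁻¹ * y - √ρ • (xᵀ * U⁻¹ * y) - √ρ • (yᵀ * U⁻¹ * x)

/-- `c_{p,q} = Γ_q(p) / Γ_q(p/2)²`. -/
def c (p q : ℕ) : ℝ := multiGamma q (p : ℝ) / multiGamma q ((p : ℝ) / 2) ^ 2

/-- `q(x,y) = (1-ρ)^{pq/2} c_{p,q} det(xᵀU⁻¹x)^{p/2} det(yᵀU⁻¹y)^{p/2} / det(R(x,y))^p`. -/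
def density {p q : ℕ} (ρ : ℝ) (U : M p p) (x y : M p q) : ℝ :=
  (1 - ρ) ^ ((p : ℝ) * q / 2) * c p q *
    (((xᵀ * U⁻¹ * x).det ^ ((p : ℝ) / 2) * (yᵀ * U⁻¹ * y).det ^ ((p : ℝ) / 2)) /
      (R ρ U x y).det ^ p)

end MpCN

end

/-! The inverse-Wishart law is conjugate to the matrix normal. Put G = xᵀU⁻¹x. As a function of V,
the product of the two densities at (V, w) again has inverse-Wishart shape, with G replaced by G +
wᵀU⁻¹w and the parameter p by 2p. Integrating V out leaves a Lebesgue density for w proportional to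
det(G + wᵀU⁻¹w)^(-p) (`lintegral_cone_mul_normalDensity`, `noiseLaw_eq_withDensity`).

Substituting w = (1-ρ)^(-1/2) (y - ρ^(1/2) x) turns G + wᵀU⁻¹w into (1-ρ)⁻¹ R(x,y)
(`gram_add_gram_eq_smul_R`), and R is symmetric in x and y. Passing from Lebesgue measure to ν_U
multiplies the density by det(yᵀU⁻¹y)^(p/2), the counterpart of the factor in x already present. The
density with respect to ν_U is therefore symmetric, and reversibility is Tonelli's theorem; the
Dirac branch sits on a null set (`ae_det_gram_ne_zero`).

The constants rest on the Jacobians of S ↦ BSBᵀ, S ↦ S⁻¹ and X ↦ AXB, and on 0 < Γ_q(a) < ∞ for a >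
(q-1)/2. Finiteness is an induction on q through Schur complements (`coneIntegral_succ_le`);
positivity holds because the cone has non-empty interior (`ball_subset_cone`). -/

noncomputable section

namespace MpCN

/-! ### Symmetric matrices in coordinates; the Jacobian of congruence. -/

/-- The index set of the coordinates of a symmetric `q × q` matrix. -/
abbrev SymIdx (q : ℕ) : Type := {ij : Fin q × Fin q // ij.1 ≤ ij.2}

/-- `symMatrix` as a linear map. -/
def symMatrixₗ (q : ℕ) : (SymIdx q → ℝ) →ₗ[ℝ] M q q where
  toFun := symMatrix q
  map_add' _ _ := rfl
  map_smul' _ _ := rfl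

/-- The entries on and above the diagonal of a matrix. -/
def symCoord (q : ℕ) : M q q →ₗ[ℝ] (SymIdx q → ℝ) where
  toFun S ij := S ij.1.1 ij.1.2
  map_add' _ _ := rfl
  map_smul' _ _ := rfl

@[simp]
theorem symCoord_apply {q : ℕ} (S : M q q) (ij : SymIdx q) :
    symCoord q S ij = S ij.1.1 ij.1.2 := rfl

@[simp]
theorem symMatrix_apply {q : ℕ} (v : SymIdx q → ℝ) (i j : Fin q) :
    symMatrix q v i j = v ⟨(min i j, max i j), min_le_max⟩ := rfl

theorem symCoord_symMatrix {q : ℕ} (v : SymIdx q → ℝ) : symCoord q (symMatrix q v) = v := by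
  funext ⟨⟨i, j⟩, h⟩
  have h' : i ≤ j := h
  simp [h']

theorem symMatrix_symCoord {q : ℕ} {S : M q q} (hS : Sᵀ = S) :
    symMatrix q (symCoord q S) = S := by
  ext i j
  rcases le_total i j with h | h
  · simp [h]
  · simp only [symMatrix_apply, symCoord_apply, h, min_eq_right, max_eq_left]
    conv_rhs => rw [← hS]
    rfl

theorem transpose_symMatrix {q : ℕ} (v : SymIdx q → ℝ) : (symMatrix q v)ᵀ = symMatrix q v := by
  ext i j
  simp [min_comm, max_comm]

theorem continuous_symMatrix (q : ℕ) : Continuous (symMatrix q) :=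
  (symMatrixₗ q).continuous_of_finiteDimensional

theorem symMatrix_injective (q : ℕ) : Function.Injective (symMatrix q) :=
  Function.LeftInverse.injective symCoord_symMatrix

/-- The congruence `S ↦ B S Bᵀ` on symmetric matrices, in coordinates. -/
def congrMap {q : ℕ} (B : M q q) : (SymIdx q → ℝ) →ₗ[ℝ] (SymIdx q → ℝ) where
  toFun v := symCoord q (B * symMatrix q v * Bᵀ)
  map_add' v w := by
    rw [show symMatrix q (v + w) = symMatrix q v + symMatrix q w from rfl, mul_add, add_mul,
      map_add]
  map_smul' a v := by
    rw [show symMatrix q (a • v) = a • symMatrix q v from rfl, mul_smul_comm, smul_mul_assoc,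
      map_smul, RingHom.id_apply]

theorem congrMap_apply {q : ℕ} (B : M q q) (v : SymIdx q → ℝ) :
    congrMap B v = symCoord q (B * symMatrix q v * Bᵀ) := rfl

theorem symMatrix_congrMap {q : ℕ} (B : M q q) (v : SymIdx q → ℝ) :
    symMatrix q (congrMap B v) = B * symMatrix q v * Bᵀ := by
  rw [congrMap_apply, symMatrix_symCoord]
  simp only [transpose_mul, transpose_symMatrix, transpose_transpose, mul_assoc]

theorem congrMap_mul {q : ℕ} (A B : M q q) : congrMap (A * B) = congrMap A ∘ₗ congrMap B := by
  refine LinearMap.ext fun v => ?_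
  apply symMatrix_injective
  rw [LinearMap.comp_apply, symMatrix_congrMap, symMatrix_congrMap, symMatrix_congrMap,
    transpose_mul]
  simp only [mul_assoc]

theorem congrMap_one (q : ℕ) : congrMap (1 : M q q) = LinearMap.id := by
  refine LinearMap.ext fun v => ?_
  apply symMatrix_injective
  simp [symMatrix_congrMap]

/-- Counting from 0, the index i is the first entry of q - i pairs and the second entry of i + 1
pairs, so d i occurs q + 1 times. -/
theorem prod_symIdx {q : ℕ} (d : Fin q → ℝ) :
    ∏ ij : SymIdx q, d ij.1.1 * d ij.1.2 = (∏ i, d i) ^ (q + 1) := by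
  rw [← Finset.prod_subtype (Finset.univ.filter fun ij : Fin q × Fin q => ij.1 ≤ ij.2)
    (fun ij => by simp) (fun ij : Fin q × Fin q => d ij.1 * d ij.2), Finset.prod_filter]
  have h1 : ∀ ij : Fin q × Fin q, (if ij.1 ≤ ij.2 then d ij.1 * d ij.2 else 1)
      = (if ij.1 ≤ ij.2 then d ij.1 else 1) * (if ij.1 ≤ ij.2 then d ij.2 else 1) := by
    intro ij; split_ifs <;> simp
  simp_rw [h1]
  rw [Finset.prod_mul_distrib, Fintype.prod_prod_type, Fintype.prod_prod_type_right,
    ← Finset.prod_mul_distrib, ← Finset.prod_pow]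
  refine Finset.prod_congr rfl fun i _ => ?_
  simp only [← Finset.prod_filter, Finset.prod_const, ← pow_add]
  congr 1
  have e1 : Finset.univ.filter (fun x : Fin q => i ≤ x) = Finset.Ici i := by ext; simp
  have e2 : Finset.univ.filter (fun x : Fin q => x ≤ i) = Finset.Iic i := by ext; simp
  rw [e1, e2, Fin.card_Ici, Fin.card_Iic]
  omega

theorem det_congrMap_diagonal {q : ℕ} (d : Fin q → ℝ) :
    LinearMap.det (congrMap (diagonal d)) = (∏ i, d i) ^ (q + 1) := by
  have h : congrMap (diagonal d)
      = Matrix.toLin' (diagonal fun ij : SymIdx q => d ij.1.1 * d ij.1.2) := by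
    refine LinearMap.ext fun v => funext fun ij => ?_
    have h' : ij.1.1 ≤ ij.1.2 := ij.2
    simp [congrMap_apply, mulVec_diagonal, diagonal_transpose, h']
    ring
  rw [h, LinearMap.det_toLin', det_diagonal, prod_symIdx]

/-- Orthogonal diagonalization of a real symmetric matrix. -/
theorem exists_orthogonal_diagonal {n : ℕ} {A : M n n} (hA : A.IsHermitian) :
    ∃ (Q : M n n) (d : Fin n → ℝ), Q * Qᵀ = 1 ∧ Qᵀ * Q = 1 ∧ A = Q * diagonal d * Qᵀ := by
  refine ⟨hA.eigenvectorUnitary, hA.eigenvalues, ?_, ?_, ?_⟩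
  · have := Unitary.coe_mul_star_self hA.eigenvectorUnitary
    rwa [Unitary.coe_star, star_eq_conjTranspose, conjTranspose_eq_transpose_of_trivial] at this
  · have := Unitary.coe_star_mul_self hA.eigenvectorUnitary
    rwa [star_eq_conjTranspose, conjTranspose_eq_transpose_of_trivial] at this
  · have := hA.spectral_theorem
    rw [Unitary.conjStarAlgAut_apply, star_eq_conjTranspose,
      conjTranspose_eq_transpose_of_trivial] at this
    exact this

theorem det_eq_prod_of_diagonalized {n : ℕ} {A Q : M n n} {d : Fin n → ℝ}
    (h1 : Q * Qᵀ = 1) (h : A = Q * diagonal d * Qᵀ) : A.det = ∏ i, d i := by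
  have h2 : Q.det * Qᵀ.det = 1 := by rw [← det_mul, h1, det_one]
  rw [h, det_mul, det_mul, det_diagonal, mul_right_comm, h2, one_mul]

/-- Congruence is multiplicative in B, so orthogonal diagonalization reduces to a diagonal B: the
contributions of Q and Qᵀ cancel, their composite being congruence by 1. -/
theorem det_congrMap {q : ℕ} {B : M q q} (hB : B.IsHermitian) :
    LinearMap.det (congrMap B) = B.det ^ (q + 1) := by
  obtain ⟨Q, d, h1, h2, h⟩ := exists_orthogonal_diagonal hB
  have h3 : LinearMap.det (congrMap Q) * LinearMap.det (congrMap Qᵀ) = 1 := by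
    rw [← LinearMap.det_comp, ← congrMap_mul, h1, congrMap_one, LinearMap.det_id]
  rw [det_eq_prod_of_diagonalized h1 h, h, congrMap_mul, congrMap_mul, LinearMap.det_comp,
    LinearMap.det_comp, det_congrMap_diagonal, mul_right_comm, h3, one_mul]

/-! ### The Jacobian of two-sided multiplication. -/

/-- The map `X ↦ A X B` on `p × q` matrices. -/
def mulLeftRight {p q : ℕ} (A : M p p) (B : M q q) :
    (Fin p → Fin q → ℝ) →ₗ[ℝ] (Fin p → Fin q → ℝ) where
  toFun X := A * of X * B
  map_add' X Y := by
    rw [← of_add_of, Matrix.mul_add, Matrix.add_mul]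
    rfl
  map_smul' a X := by
    rw [← smul_of, Matrix.mul_smul, Matrix.smul_mul]
    rfl

theorem mulLeftRight_mul {p q : ℕ} (A A' : M p p) (B B' : M q q) :
    mulLeftRight (A * A') (B' * B) = mulLeftRight A B ∘ₗ mulLeftRight A' B' := by
  refine LinearMap.ext fun X => ?_
  change A * A' * of X * (B' * B) = A * (A' * of X * B') * B
  simp only [Matrix.mul_assoc]

theorem mulLeftRight_one (p q : ℕ) : mulLeftRight (1 : M p p) (1 : M q q) = LinearMap.id := by
  refine LinearMap.ext fun X => ?_
  change (1 : M p p) * of X * (1 : M q q) = of X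
  rw [Matrix.one_mul, Matrix.mul_one]

/-- Diagonal factors rescale the entry (i, j) by a i * b j, so the map is diagonal on the p * q
entries. -/
theorem det_mulLeftRight_diagonal {p q : ℕ} (a : Fin p → ℝ) (b : Fin q → ℝ) :
    LinearMap.det (mulLeftRight (diagonal a) (diagonal b))
      = (∏ i, a i) ^ q * (∏ j, b j) ^ p := by
  let e : (Fin p → Fin q → ℝ) ≃ₗ[ℝ] (Fin p × Fin q → ℝ) := (LinearEquiv.curry ℝ ℝ _ _).symm
  have h : e.toLinearMap ∘ₗ mulLeftRight (diagonal a) (diagonal b) ∘ₗ e.symm.toLinearMap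
      = Matrix.toLin' (diagonal fun ij : Fin p × Fin q => a ij.1 * b ij.2) := by
    refine LinearMap.ext fun v => funext fun ij => ?_
    rw [toLin'_apply, mulVec_diagonal]
    change (diagonal a * (Matrix.of fun i j => v (i, j)) * diagonal b) ij.1 ij.2 = _
    rw [mul_diagonal, diagonal_mul, of_apply]
    ring
  rw [← LinearMap.det_conj _ e, h, LinearMap.det_toLin', det_diagonal, Finset.prod_mul_distrib,
    Fintype.prod_prod_type, Fintype.prod_prod_type_right]
  simp [Finset.prod_pow]

theorem det_mulLeftRight {p q : ℕ} {A : M p p} {B : M q q} (hA : A.IsHermitian)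
    (hB : B.IsHermitian) :
    LinearMap.det (mulLeftRight A B) = A.det ^ q * B.det ^ p := by
  obtain ⟨Q, d, h1, h2, h⟩ := exists_orthogonal_diagonal hA
  obtain ⟨Q', d', h1', h2', h'⟩ := exists_orthogonal_diagonal hB
  have h3 : LinearMap.det (mulLeftRight Q Q'ᵀ) * LinearMap.det (mulLeftRight Qᵀ Q') = 1 := by
    rw [← LinearMap.det_comp, ← mulLeftRight_mul, h1, h1', mulLeftRight_one, LinearMap.det_id]
  have h4 : mulLeftRight A B
      = mulLeftRight Q Q'ᵀ ∘ₗ mulLeftRight (diagonal d) (diagonal d') ∘ₗ mulLeftRight Qᵀ Q' := by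
    rw [← mulLeftRight_mul, ← mulLeftRight_mul, ← Matrix.mul_assoc, ← h, ← h']
  rw [det_eq_prod_of_diagonalized h1 h, det_eq_prod_of_diagonalized h1' h', h4,
    LinearMap.det_comp, LinearMap.det_comp, det_mulLeftRight_diagonal, mul_left_comm, h3, mul_one]

/-! ### Square roots and the positive definite cone. -/

/-- The symmetric positive definite square root. -/
theorem exists_posDef_sqrt {n : ℕ} {A : M n n} (hA : A.PosDef) :
    ∃ C : M n n, C.PosDef ∧ C * C = A := by
  obtain ⟨Q, d, h1, h2, h⟩ := exists_orthogonal_diagonal hA.isHermitian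
  have hQ : IsUnit Qᵀ := isUnit_iff_exists.2 ⟨Q, h2, h1⟩
  have hd : (diagonal d).PosDef := by
    have h3 : diagonal d = star Q * A * Q := by
      rw [star_eq_conjTranspose, conjTranspose_eq_transpose_of_trivial, h]
      calc diagonal d = (Qᵀ * Q) * diagonal d * (Qᵀ * Q) := by rw [h2, one_mul, mul_one]
        _ = _ := by simp only [mul_assoc]
    rw [h3]
    exact (Matrix.IsUnit.posDef_star_left_conjugate_iff (isUnit_iff_exists.2 ⟨Qᵀ, h1, h2⟩)).2 hA
  have hd0 : ∀ i, 0 < d i := posDef_diagonal_iff.1 hd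
  refine ⟨Q * diagonal (fun i => √(d i)) * Qᵀ, ?_, ?_⟩
  · have := (Matrix.IsUnit.posDef_star_left_conjugate_iff hQ).2
      (posDef_diagonal_iff.2 fun i => Real.sqrt_pos.2 (hd0 i))
    rwa [star_eq_conjTranspose, conjTranspose_eq_transpose_of_trivial, transpose_transpose] at this
  · calc _ = Q * diagonal (fun i => √(d i)) * (Qᵀ * Q) * diagonal (fun i => √(d i)) * Qᵀ := by
          simp only [mul_assoc]
      _ = A := by
          rw [h2, mul_one, mul_assoc Q, diagonal_mul_diagonal, h]
          simp only [Real.mul_self_sqrt (hd0 _).le]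

theorem posDef_iff_posSemidef_det {n : ℕ} {A : M n n} :
    A.PosDef ↔ A.PosSemidef ∧ A.det ≠ 0 := by
  refine ⟨fun h => ⟨h.posSemidef, h.det_pos.ne'⟩, fun h => ?_⟩
  rw [h.1.posDef_iff_isUnit, isUnit_iff_isUnit_det]
  exact h.2.isUnit

/-- Semidefiniteness is a closed condition, an intersection over all test vectors; definiteness adds
only the non-vanishing of the determinant. -/
theorem measurableSet_posDefSet (n : ℕ) : MeasurableSet (posDefSet n) := by
  have h : posDefSet n = ({S : M n n | Sᵀ = S} ∩ ⋂ x : Fin n → ℝ, {S | 0 ≤ x ⬝ᵥ (S *ᵥ x)}) ∩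
      {S : M n n | S.det = 0}ᶜ := by
    ext S
    simp only [posDefSet, Set.mem_ofPred_eq, posDef_iff_posSemidef_det,
      posSemidef_iff_dotProduct_mulVec, IsHermitian, conjTranspose_eq_transpose_of_trivial,
      star_trivial, Set.mem_inter_iff, Set.mem_iInter, Set.mem_compl_iff]
  rw [h]
  refine MeasurableSet.inter (IsClosed.measurableSet ?_) ?_
  · refine (isClosed_eq (by fun_prop) (by fun_prop)).inter (isClosed_iInter fun x => ?_)
    exact isClosed_le (by fun_prop) (by fun_prop)
  · exact (measurable_det n (measurableSet_singleton 0)).compl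

/-- The positive definite cone in coordinates. -/
def cone (q : ℕ) : Set (SymIdx q → ℝ) := symMatrix q ⁻¹' posDefSet q

theorem measurableSet_cone (q : ℕ) : MeasurableSet (cone q) :=
  (continuous_symMatrix q).measurable (measurableSet_posDefSet q)

theorem posDef_of_mem_cone {q : ℕ} {v : SymIdx q → ℝ} (hv : v ∈ cone q) :
    (symMatrix q v).PosDef := hv

theorem symMatrix_symCoord_of_posDef {q : ℕ} {S : M q q} (hS : S.PosDef) :
    symMatrix q (symCoord q S) = S :=
  symMatrix_symCoord (by simpa using hS.isHermitian.eq)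

theorem symCoord_mem_cone {q : ℕ} {S : M q q} (hS : S.PosDef) : symCoord q S ∈ cone q := by
  change (symMatrix q (symCoord q S)).PosDef
  rwa [symMatrix_symCoord_of_posDef hS]

theorem posDef_congr {q : ℕ} {C S : M q q} (hC : C.PosDef) (hS : S.PosDef) :
    (C * S * C).PosDef := by
  have := (Matrix.IsUnit.posDef_star_left_conjugate_iff hC.isUnit).2 hS
  rwa [star_eq_conjTranspose, hC.isHermitian.eq] at this

/-! ### Changes of variables on the cone. -/

theorem setLIntegral_symLeb {q : ℕ} {f : M q q → ENNReal} (hf : Measurable f) :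
    ∫⁻ S in posDefSet q, f S ∂(symLeb q) = ∫⁻ v in cone q, f (symMatrix q v) := by
  rw [symLeb, Measure.restrict_map (continuous_symMatrix q).measurable (measurableSet_posDefSet q),
    lintegral_map hf (continuous_symMatrix q).measurable]
  rfl

/-- S ↦ CSC is a linear bijection of the cone, with inverse given by C⁻¹, and its determinant is
det(C)^(q+1). -/
theorem lintegral_cone_congr {q : ℕ} {C : M q q} (hC : C.PosDef) (g : M q q → ENNReal) :
    ∫⁻ v in cone q, g (symMatrix q v)
      = ∫⁻ v in cone q, ENNReal.ofReal (C.det ^ (q + 1)) * g (C * symMatrix q v * C) := by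
  have hCt : Cᵀ = C := by simpa using hC.isHermitian.eq
  have hu : IsUnit C.det := hC.det_pos.ne'.isUnit
  have himg : congrMap C '' cone q = cone q := by
    apply Set.Subset.antisymm
    · rintro _ ⟨v, hv, rfl⟩
      change (symMatrix q (congrMap C v)).PosDef
      rw [symMatrix_congrMap, hCt]
      exact posDef_congr hC hv
    · intro v hv
      refine ⟨congrMap C⁻¹ v, ?_, ?_⟩
      · change (symMatrix q (congrMap C⁻¹ v)).PosDef
        rw [symMatrix_congrMap, transpose_nonsing_inv, hCt]
        exact posDef_congr hC.inv hv
      · rw [← LinearMap.comp_apply, ← congrMap_mul, mul_nonsing_inv _ hu, congrMap_one,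
          LinearMap.id_apply]
  have hinj : Set.InjOn (congrMap C) (cone q) := by
    refine Function.Injective.injOn (Function.LeftInverse.injective (g := congrMap C⁻¹) fun v => ?_)
    rw [← LinearMap.comp_apply, ← congrMap_mul, nonsing_inv_mul _ hu, congrMap_one,
      LinearMap.id_apply]
  have h := lintegral_image_eq_lintegral_abs_det_fderiv_mul volume (measurableSet_cone q)
    (f := congrMap C) (f' := fun _ => (congrMap C).toContinuousLinearMap)
    (fun v _ => (congrMap C).toContinuousLinearMap.hasFDerivAt.hasFDerivWithinAt) hinj
    (fun v => g (symMatrix q v))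
  rw [himg] at h
  rw [h]
  refine setLIntegral_congr_fun (measurableSet_cone q) fun v _ => ?_
  simp only [LinearMap.det_toContinuousLinearMap, det_congrMap hC.isHermitian, symMatrix_congrMap,
    hCt, abs_of_pos (pow_pos hC.det_pos _)]

section Inversion

-- An algebra norm serves only to differentiate ring inversion.
attribute [local instance] Matrix.linftyOpNormedRing Matrix.linftyOpNormedAlgebra

/-- The derivative of S ↦ S⁻¹ sends H to -S⁻¹HS⁻¹, which is minus a congruence, so its determinant
is already known up to sign. -/
theorem hasFDerivAt_symCoord_inv {q : ℕ} {v : SymIdx q → ℝ} (hv : v ∈ cone q) :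
    HasFDerivAt (fun v => symCoord q (symMatrix q v)⁻¹)
      (-(congrMap (symMatrix q v)⁻¹)).toContinuousLinearMap v := by
  have hS := posDef_of_mem_cone hv
  obtain ⟨u, hu⟩ := hS.isUnit
  have h1 : HasFDerivAt (symMatrixₗ q) (symMatrixₗ q).toContinuousLinearMap v :=
    (symMatrixₗ q).toContinuousLinearMap.hasFDerivAt
  have h2 := hasFDerivAt_ringInverse (𝕜 := ℝ) u
  have h3 : HasFDerivAt (symCoord q) (symCoord q).toContinuousLinearMap
    (Ring.inverse (u : M q q)) := (symCoord q).toContinuousLinearMap.hasFDerivAt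
  have huS : (u : M q q) = symMatrixₗ q v := hu
  have h4 := (h3.comp (u : M q q) h2)
  rw [huS] at h4
  have h5 := h4.comp v h1
  have hi : ((u⁻¹ : (M q q)ˣ) : M q q) = (symMatrix q v)⁻¹ := by
    rw [coe_units_inv, hu]
  have hcomp : (fun v => symCoord q (symMatrix q v)⁻¹)
      = (symCoord q ∘ Ring.inverse) ∘ symMatrixₗ q := by
    funext w
    simp only [Function.comp_apply, nonsing_inv_eq_ringInverse]
    rfl
  rw [hcomp]
  refine h5.congr_fderiv (ContinuousLinearMap.ext fun w => ?_)
  have hit : ((symMatrix q v)⁻¹)ᵀ = (symMatrix q v)⁻¹ := by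
    rw [transpose_nonsing_inv, transpose_symMatrix]
  simp only [hi, _root_.neg_apply, map_neg, LinearMap.coe_toContinuousLinearMap', congrMap_apply,
    hit]
  rfl

end Inversion

/-- Inversion is an involution of the cone, and the sign of its Jacobian disappears in the absolute
value. -/
theorem lintegral_cone_inv {q : ℕ} (g : M q q → ENNReal) :
    ∫⁻ v in cone q, g (symMatrix q v)
      = ∫⁻ v in cone q, ENNReal.ofReal ((symMatrix q v).det⁻¹ ^ (q + 1)) *
          g (symMatrix q v)⁻¹ := by
  set f : (SymIdx q → ℝ) → (SymIdx q → ℝ) := fun v => symCoord q (symMatrix q v)⁻¹ with hf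
  have hmat : ∀ v ∈ cone q, symMatrix q (f v) = (symMatrix q v)⁻¹ := fun v hv =>
    symMatrix_symCoord_of_posDef (posDef_of_mem_cone hv).inv
  have hmem : ∀ v ∈ cone q, f v ∈ cone q := fun v hv =>
    symCoord_mem_cone (posDef_of_mem_cone hv).inv
  have hff : ∀ v ∈ cone q, f (f v) = v := fun v hv => by
    rw [hf]
    change symCoord q (symMatrix q (f v))⁻¹ = v
    rw [hmat v hv, nonsing_inv_nonsing_inv _ (posDef_of_mem_cone hv).det_pos.ne'.isUnit,
      symCoord_symMatrix]
  have himg : f '' cone q = cone q :=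
    Set.Subset.antisymm (Set.image_subset_iff.2 hmem) fun v hv => ⟨f v, hmem v hv, hff v hv⟩
  have hinj : Set.InjOn f (cone q) := fun v hv w hw h => by rw [← hff v hv, h, hff w hw]
  have h := lintegral_image_eq_lintegral_abs_det_fderiv_mul volume (measurableSet_cone q)
    (fun v hv => (hasFDerivAt_symCoord_inv hv).hasFDerivWithinAt) hinj
    (fun v => g (symMatrix q v))
  rw [himg] at h
  rw [h]
  refine setLIntegral_congr_fun (measurableSet_cone q) fun v hv => ?_
  have hS := (posDef_of_mem_cone hv).inv
  have hd : |LinearMap.det (-(congrMap (symMatrix q v)⁻¹))| = (symMatrix q v).det⁻¹ ^ (q + 1) := by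
    rw [← neg_one_smul ℝ, LinearMap.det_smul, det_congrMap hS.isHermitian, abs_mul, abs_pow,
      abs_neg, abs_one, one_pow, one_mul, abs_of_pos (pow_pos hS.det_pos _), det_nonsing_inv,
      Ring.inverse_eq_inv']
  have he : symMatrix q (symCoord q (symMatrix q v)⁻¹) = (symMatrix q v)⁻¹ := hmat v hv
  simp only [LinearMap.det_toContinuousLinearMap, hd, he]

/-! ### Gamma integrals on the cone. -/

/-- The integral over the cone of `det(S)^{r-(q+1)/2} exp(-tr(AS))`. -/
def coneIntegral {q : ℕ} (r : ℝ) (A : M q q) : ENNReal :=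
  ∫⁻ v in cone q, ENNReal.ofReal
    ((symMatrix q v).det ^ (r - ((q : ℝ) + 1) / 2) * Real.exp (-(A * symMatrix q v).trace))

/-- Substitute S ↦ CSC with C = A^(-1/2): then CAC = 1 removes A from the trace, and det(C)² =
det(A)⁻¹ collects into det(A)^(-r). Both sides are extended non-negative, so r is unrestricted. -/
theorem coneIntegral_eq {q : ℕ} (r : ℝ) {A : M q q} (hA : A.PosDef) :
    coneIntegral r A = ENNReal.ofReal (A.det ^ (-r)) * coneIntegral r (1 : M q q) := by
  obtain ⟨C, hC, hCA⟩ := exists_posDef_sqrt hA.inv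
  have hdet : C.det ^ 2 = A.det⁻¹ := by
    rw [sq, ← det_mul, hCA, det_nonsing_inv, Ring.inverse_eq_inv']
  have hAC : C * A * C = 1 := by
    have h1 : A * C * C = 1 := by
      rw [mul_assoc, hCA, mul_nonsing_inv _ hA.det_pos.ne'.isUnit]
    rw [mul_assoc, mul_eq_one_comm, h1]
  have hCr : C.det ^ (q + 1) * (C.det ^ 2) ^ (r - ((q : ℝ) + 1) / 2) = A.det ^ (-r) := by
    rw [Real.rpow_neg hA.det_pos.le, ← Real.inv_rpow hA.det_pos.le, ← hdet, ← Real.rpow_natCast,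
      ← Real.rpow_natCast, ← Real.rpow_mul hC.det_pos.le, ← Real.rpow_mul hC.det_pos.le,
      ← Real.rpow_add hC.det_pos]
    congr 1
    push_cast
    ring
  unfold coneIntegral
  rw [lintegral_cone_congr hC fun S : M q q => ENNReal.ofReal
    (S.det ^ (r - ((q : ℝ) + 1) / 2) * Real.exp (-(A * S).trace)),
    ← lintegral_const_mul' _ _ ENNReal.ofReal_ne_top]
  refine setLIntegral_congr_fun (measurableSet_cone q) fun v hv => ?_
  have hS := posDef_of_mem_cone hv
  have htr : (A * (C * symMatrix q v * C)).trace = (1 * symMatrix q v).trace := by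
    rw [← mul_assoc, trace_mul_comm, ← mul_assoc, ← mul_assoc, hAC]
  have hd : (C * symMatrix q v * C).det = C.det ^ 2 * (symMatrix q v).det := by
    rw [det_mul, det_mul]; ring
  rw [← ENNReal.ofReal_mul (pow_pos hC.det_pos _).le,
    ← ENNReal.ofReal_mul (Real.rpow_nonneg hA.det_pos.le _), htr, hd,
    Real.mul_rpow (sq_nonneg _) hS.det_pos.le, ← hCr]
  congr 1
  ring

/-- Under inversion the exponent r - (q+1)/2 changes sign and the Jacobian subtracts q + 1, which
gives -r - (q+1)/2. -/
theorem lintegral_cone_inv_exp {q : ℕ} (r : ℝ) (A : M q q) :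
    ∫⁻ v in cone q, ENNReal.ofReal ((symMatrix q v).det ^ (-r - ((q : ℝ) + 1) / 2) *
      Real.exp (-(A * (symMatrix q v)⁻¹).trace)) = coneIntegral r A := by
  unfold coneIntegral
  rw [lintegral_cone_inv fun S : M q q => ENNReal.ofReal
    (S.det ^ (r - ((q : ℝ) + 1) / 2) * Real.exp (-(A * S).trace))]
  refine setLIntegral_congr_fun (measurableSet_cone q) fun v hv => ?_
  have hS := posDef_of_mem_cone hv
  rw [← ENNReal.ofReal_mul (pow_pos (inv_pos.2 hS.det_pos) _).le, ← mul_assoc, det_nonsing_inv,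
    Ring.inverse_eq_inv', ← Real.rpow_natCast, ← Real.rpow_add (inv_pos.2 hS.det_pos),
    Real.inv_rpow hS.det_pos.le, ← Real.rpow_neg hS.det_pos.le]
  congr 4
  push_cast
  ring

/-! ### Gaussian integrals over matrices. -/

theorem lintegral_eq_det_mul_lintegral_comp {E : Type*} [NormedAddCommGroup E] [NormedSpace ℝ E]
    [MeasurableSpace E] [BorelSpace E] [FiniteDimensional ℝ E] (μ : Measure E)
    [μ.IsAddHaarMeasure] {f : E →ₗ[ℝ] E} (hf : LinearMap.det f ≠ 0) {g : E → ENNReal}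
    (hg : Measurable g) :
    ∫⁻ x, g x ∂μ = ENNReal.ofReal |LinearMap.det f| * ∫⁻ x, g (f x) ∂μ := by
  have hfm : Measurable f := f.continuous_of_finiteDimensional.measurable
  rw [← lintegral_map hg hfm, Measure.map_linearMap_addHaar_eq_smul_addHaar μ hf,
    lintegral_smul_measure, smul_eq_mul, ← mul_assoc, ← ENNReal.ofReal_mul (abs_nonneg _),
    ← abs_mul, mul_inv_cancel₀ hf, abs_one, ENNReal.ofReal_one, one_mul]

theorem trace_transpose_mul_self {p q : ℕ} (X : M p q) :
    (Xᵀ * X).trace = ∑ i, ∑ j, X i j ^ 2 := by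
  simp only [trace, diag_apply, mul_apply, transpose_apply, ← sq]
  exact Finset.sum_comm

theorem lintegral_exp_neg_trace (p q : ℕ) :
    ∫⁻ X : M p q, ENNReal.ofReal (Real.exp (-(Xᵀ * X).trace / 2))
      = ENNReal.ofReal ((2 * Real.pi) ^ ((p : ℝ) * q / 2)) := by
  have h1 : ∀ X : Fin p → Fin q → ℝ, Real.exp (-((of X)ᵀ * of X).trace / 2)
      = ∏ i, ∏ j, Real.exp (-(1 / 2) * X i j ^ 2) := by
    intro X
    simp_rw [← Real.exp_sum, trace_transpose_mul_self, ← Finset.mul_sum, of_apply]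
    congr 1
    ring
  have h2 : ∫ X : Fin p → Fin q → ℝ, ∏ i, ∏ j, Real.exp (-(1 / 2) * X i j ^ 2)
      = (2 * Real.pi) ^ ((p : ℝ) * q / 2) := by
    rw [integral_fintype_prod_volume_eq_pow
        (fun x : Fin q → ℝ => ∏ j, Real.exp (-(1 / 2) * x j ^ 2)),
      integral_fintype_prod_volume_eq_pow (fun x : ℝ => Real.exp (-(1 / 2) * x ^ 2)),
      integral_gaussian, Fintype.card_fin, Fintype.card_fin, ← pow_mul, Real.sqrt_eq_rpow,
      ← Real.rpow_natCast, ← Real.rpow_mul (by positivity)]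
    congr 1
    · ring
    · push_cast
      ring
  -- A non-integrable function has Bochner integral 0, so the non-zero value just computed yields
  -- integrability.
  have h3 : Integrable fun X : Fin p → Fin q → ℝ => ∏ i, ∏ j, Real.exp (-(1 / 2) * X i j ^ 2) :=
    Integrable.of_integral_ne_zero (by rw [h2]; positivity)
  rw [← h2, ofReal_integral_eq_lintegral_ofReal h3
    (Filter.Eventually.of_forall fun X => by positivity)]
  exact lintegral_congr fun X => congrArg ENNReal.ofReal (h1 X)

/-- The substitution X ↦ U^(1/2) X V^(1/2) reduces to the standard Gaussian, with Jacobian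
det(U)^(q/2) det(V)^(p/2). -/
theorem lintegral_exp_neg_trace_inv {p q : ℕ} {U : M p p} {V : M q q} (hU : U.PosDef)
    (hV : V.PosDef) :
    ∫⁻ X : M p q, ENNReal.ofReal (Real.exp (-(V⁻¹ * Xᵀ * U⁻¹ * X).trace / 2))
      = ENNReal.ofReal ((2 * Real.pi) ^ ((p : ℝ) * q / 2) * U.det ^ ((q : ℝ) / 2) *
          V.det ^ ((p : ℝ) / 2)) := by
  obtain ⟨A, hA, hAU⟩ := exists_posDef_sqrt hU
  obtain ⟨B, hB, hBV⟩ := exists_posDef_sqrt hV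
  have hdet := det_mulLeftRight hA.isHermitian hB.isHermitian
  have hdet0 : 0 < LinearMap.det (mulLeftRight A B) := by
    rw [hdet]
    exact mul_pos (pow_pos hA.det_pos _) (pow_pos hB.det_pos _)
  have hg : Measurable fun X : M p q =>
      ENNReal.ofReal (Real.exp (-(V⁻¹ * Xᵀ * U⁻¹ * X).trace / 2)) :=
    (Continuous.measurable (by fun_prop)).ennreal_ofReal
  have hAt : Aᵀ = A := by simpa using hA.isHermitian.eq
  have hBt : Bᵀ = B := by simpa using hB.isHermitian.eq
  have hAU' : A * U⁻¹ * A = 1 := by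
    rw [mul_assoc, mul_eq_one_comm, mul_assoc, hAU, nonsing_inv_mul _ hU.det_pos.ne'.isUnit]
  have hBV' : B * V⁻¹ * B = 1 := by
    rw [mul_assoc, mul_eq_one_comm, mul_assoc, hBV, nonsing_inv_mul _ hV.det_pos.ne'.isUnit]
  have htr : ∀ X : M p q, (V⁻¹ * (A * X * B)ᵀ * U⁻¹ * (A * X * B)).trace = (Xᵀ * X).trace := by
    intro X
    have e : V⁻¹ * (A * X * B)ᵀ * U⁻¹ * (A * X * B)
        = (V⁻¹ * B) * (Xᵀ * (A * U⁻¹ * A) * X) * B := by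
      simp only [transpose_mul, hAt, hBt, Matrix.mul_assoc]
    rw [e, trace_mul_comm, ← Matrix.mul_assoc, ← Matrix.mul_assoc B, hBV', hAU', Matrix.mul_one,
      Matrix.one_mul]
  have h := lintegral_eq_det_mul_lintegral_comp (volume : Measure (Fin p → Fin q → ℝ)) hdet0.ne' hg
  refine h.trans ?_
  have h' : ∫⁻ X : Fin p → Fin q → ℝ, ENNReal.ofReal (Real.exp
        (-(V⁻¹ * (of (mulLeftRight A B X))ᵀ * U⁻¹ * of (mulLeftRight A B X)).trace / 2))
      = ENNReal.ofReal ((2 * Real.pi) ^ ((p : ℝ) * q / 2)) := by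
    rw [← lintegral_exp_neg_trace]
    exact lintegral_congr fun X =>
      congrArg (fun t : ℝ => ENNReal.ofReal (Real.exp (-t / 2))) (htr (of X))
  refine (congrArg _ h').trans ?_
  rw [← ENNReal.ofReal_mul (abs_nonneg _), abs_of_pos hdet0, hdet, ← hAU, ← hBV, det_mul, det_mul,
    ← sq, ← sq, ← Real.rpow_natCast_mul hA.det_pos.le, ← Real.rpow_natCast_mul hB.det_pos.le]
  congr 1
  rw [show ((2 : ℕ) : ℝ) * ((q : ℝ) / 2) = (q : ℕ) by push_cast; ring,
    show ((2 : ℕ) : ℝ) * ((p : ℝ) / 2) = (p : ℕ) by push_cast; ring, Real.rpow_natCast,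
    Real.rpow_natCast]
  ring

theorem lintegral_normalDensity {p q : ℕ} {U : M p p} {V : M q q} (hU : U.PosDef)
    (hV : V.PosDef) :
    ∫⁻ X : M p q, ENNReal.ofReal (normalDensity 0 U V X) = 1 := by
  have hc : 0 < (2 * Real.pi) ^ ((p : ℝ) * q / 2) * U.det ^ ((q : ℝ) / 2) *
      V.det ^ ((p : ℝ) / 2) := by
    have := Real.rpow_pos_of_pos hU.det_pos ((q : ℝ) / 2)
    have := Real.rpow_pos_of_pos hV.det_pos ((p : ℝ) / 2)
    positivity
  simp only [normalDensity, sub_zero, div_eq_mul_inv _ (_ * _ * _),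
    ENNReal.ofReal_mul (Real.exp_nonneg _)]
  rw [lintegral_mul_const' _ _ ENNReal.ofReal_ne_top, lintegral_exp_neg_trace_inv hU hV,
    ← ENNReal.ofReal_mul hc.le, mul_inv_cancel₀ hc.ne', ENNReal.ofReal_one]

/-! ### Almost every Gram matrix is nonsingular. -/

theorem posSemidef_gram {p q : ℕ} {U : M p p} (hU : U.PosDef) (x : M p q) :
    (xᵀ * U⁻¹ * x).PosSemidef := by
  have := hU.inv.posSemidef.conjTranspose_mul_mul_same x
  rwa [conjTranspose_eq_transpose_of_trivial] at this

theorem posDef_gram {p q : ℕ} {U : M p p} (hU : U.PosDef) {x : M p q}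
    (hx : (xᵀ * U⁻¹ * x).det ≠ 0) : (xᵀ * U⁻¹ * x).PosDef :=
  posDef_iff_posSemidef_det.2 ⟨posSemidef_gram hU x, hx⟩

/-- An invertible top q × q block makes x injective, and the Gram matrix of an injective map is
positive definite. -/
theorem det_gram_ne_zero {p q : ℕ} (hqp : q ≤ p) {U : M p p} (hU : U.PosDef) {x : M p q}
    (hx : (x.submatrix (Fin.castLE hqp) id).det ≠ 0) : (xᵀ * U⁻¹ * x).det ≠ 0 := by
  have hinj : Function.Injective x.mulVec := by
    intro v w h
    refine mulVec_injective_iff_isUnit.2 ((isUnit_iff_isUnit_det _).2 hx.isUnit) ?_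
    funext i
    exact congrFun h (Fin.castLE hqp i)
  have := hU.inv.conjTranspose_mul_mul_same hinj
  rw [conjTranspose_eq_transpose_of_trivial] at this
  exact this.det_pos.ne'

/-- It suffices that every line in one fixed direction meets the exceptional set in a null set.
Along E, whose top block is the identity, the determinant of the top block is a monic polynomial in
t, so it has finitely many zeros. -/
theorem ae_det_gram_ne_zero {p q : ℕ} (hqp : q ≤ p) {U : M p p} (hU : U.PosDef) :
    ∀ᵐ x : M p q, (xᵀ * U⁻¹ * x).det ≠ 0 := by
  let s : Set (Fin p → Fin q → ℝ) := {x | ((of x)ᵀ * U⁻¹ * of x).det ≠ 0}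
  have hs : MeasurableSet s :=
    (((measurable_det q).comp (measurable_gram U)) (measurableSet_singleton 0)).compl
  let E : Fin p → Fin q → ℝ := fun i j => if i = Fin.castLE hqp j then 1 else 0
  refine ae_mem_of_ae_add_linearMap_mem (LinearMap.toSpanSingleton ℝ (Fin p → Fin q → ℝ) E)
    volume (volume : Measure (Fin p → Fin q → ℝ)) hs fun y => ?_
  set A : M q q := (of y).submatrix (Fin.castLE hqp) id
  have hfin : {t : ℝ | (-A).charpoly.eval t = 0}.Finite :=
    Polynomial.finite_setOfPred_isRoot (charpoly_monic (-A)).ne_zero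
  refine measure_mono_null (fun t ht => ?_) (hfin.measure_zero volume)
  by_contra hne
  refine ht (det_gram_ne_zero hqp hU (x := of (y + t • E)) ?_)
  -- The top block is A + t, written as t - (-A) to match the characteristic polynomial of -A.
  have h : (of (y + t • E)).submatrix (Fin.castLE hqp) id = scalar (Fin q) t - -A := by
    ext i j
    simp [E, A, scalar_apply, diagonal_apply, (Fin.castLE_injective hqp).eq_iff, add_comm]
  rw [h, ← eval_charpoly]
  exact hne

/-! ### Finiteness of the multivariate Gamma function, by splitting off the last row and column. -/

theorem lintegral_sum_pi {ι κ : Type*} [Fintype ι] [Fintype κ] {F : (ι ⊕ κ → ℝ) → ENNReal}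
    (hF : Measurable F) :
    ∫⁻ v, F v = ∫⁻ a : ι → ℝ, ∫⁻ b : κ → ℝ, F (Sum.elim a b) := by
  have h := volume_measurePreserving_sumPiEquivProdPi_symm (fun _ : ι ⊕ κ => ℝ)
  rw [← h.lintegral_comp hF, Measure.volume_eq_prod,
    lintegral_prod (fun z => F ((MeasurableEquiv.sumPiEquivProdPi fun _ => ℝ).symm z))
      (hF.comp h.measurable).aemeasurable]
  refine lintegral_congr fun a => lintegral_congr fun b => congrArg F ?_
  funext i
  cases i <;> rfl

theorem lintegral_comp_equiv_pi {ι κ : Type*} [Fintype ι] [Fintype κ] (e : ι ≃ κ)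
    {F : (κ → ℝ) → ENNReal} (hF : Measurable F) :
    ∫⁻ v, F v = ∫⁻ w : ι → ℝ, F (w ∘ e.symm) := by
  have h := volume_measurePreserving_piCongrLeft (fun _ : κ => ℝ) e
  rw [← h.lintegral_comp hF]
  refine lintegral_congr fun w => congrArg F ?_
  funext k
  obtain ⟨i, rfl⟩ := e.surjective k
  rw [Function.comp_apply, e.symm_apply_apply]
  exact MeasurableEquiv.piCongrLeft_apply_apply _ _ _

theorem lintegral_unit_pi {F : (Unit → ℝ) → ENNReal} (hF : Measurable F) :
    ∫⁻ v, F v = ∫⁻ c : ℝ, F fun _ => c := by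
  have h := (volume_preserving_funUnique Unit ℝ).symm
  rw [← h.lintegral_comp hF]
  rfl

/-- Allows a Gaussian integral over vectors to be read as the q × 1 case of the matrix one. -/
theorem lintegral_vector_eq_lintegral_column {q : ℕ} {F : (Fin q → ℝ) → ENNReal}
    (hF : Measurable F) : ∫⁻ b, F b = ∫⁻ X : M q 1, F fun i => X i 0 := by
  have h := volume_preserving_pi (fun _ : Fin q => volume_preserving_funUnique (Fin 1) ℝ)
  rw [← h.lintegral_comp hF]
  rfl

/-- The coordinates of a symmetric `(q+1) × (q+1)` matrix, split into those of its leading block,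
those of its last column above the diagonal, and the last diagonal one. -/
def symIdxSplit (q : ℕ) : SymIdx q ⊕ (Fin q ⊕ Unit) → SymIdx (q + 1)
  | .inl ij => ⟨(ij.1.1.castSucc, ij.1.2.castSucc), Fin.castSucc_le_castSucc_iff.2 ij.2⟩
  | .inr (.inl i) => ⟨(i.castSucc, Fin.last q), Fin.le_last _⟩
  | .inr (.inr _) => ⟨(Fin.last q, Fin.last q), le_rfl⟩

theorem bijective_symIdxSplit (q : ℕ) : Function.Bijective (symIdxSplit q) := by
  constructor
  · rintro (⟨⟨i, j⟩, h⟩ | i | _) (⟨⟨i', j'⟩, h'⟩ | i' | _) <;>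
      simp [symIdxSplit, Fin.castSucc_ne_last, (Fin.castSucc_ne_last _).symm]
  · rintro ⟨⟨i, j⟩, h⟩
    induction j using Fin.lastCases with
    | last =>
      induction i using Fin.lastCases with
      | last => exact ⟨.inr (.inr ()), rfl⟩
      | cast i => exact ⟨.inr (.inl i), rfl⟩
    | cast j =>
      induction i using Fin.lastCases with
      | last => exact absurd h (not_le.2 (Fin.castSucc_lt_last j))
      | cast i => exact ⟨.inl ⟨(i, j), Fin.castSucc_le_castSucc_iff.1 h⟩, rfl⟩

/-- `symIdxSplit` as an equivalence. -/
def symIdxEquiv (q : ℕ) : SymIdx q ⊕ (Fin q ⊕ Unit) ≃ SymIdx (q + 1) :=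
  Equiv.ofBijective _ (bijective_symIdxSplit q)

/-- The coordinates of the symmetric matrix with leading block `a`, last column `b` and last
diagonal entry `c`. -/
def glue {q : ℕ} (a : SymIdx q → ℝ) (b : Fin q → ℝ) (c : ℝ) : SymIdx (q + 1) → ℝ :=
  Sum.elim a (Sum.elim b fun _ => c) ∘ (symIdxEquiv q).symm

theorem glue_symIdxSplit {q : ℕ} (a : SymIdx q → ℝ) (b : Fin q → ℝ) (c : ℝ)
    (k : SymIdx q ⊕ (Fin q ⊕ Unit)) :
    glue a b c (symIdxSplit q k) = Sum.elim a (Sum.elim b fun _ => c) k :=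
  congrArg _ ((symIdxEquiv q).symm_apply_apply k)

theorem lintegral_glue {q : ℕ} {F : (SymIdx (q + 1) → ℝ) → ENNReal} (hF : Measurable F) :
    ∫⁻ v, F v = ∫⁻ a : SymIdx q → ℝ, ∫⁻ b : Fin q → ℝ, ∫⁻ c : ℝ, F (glue a b c) := by
  have h1 : Measurable fun w : SymIdx q ⊕ (Fin q ⊕ Unit) → ℝ => F (w ∘ (symIdxEquiv q).symm) :=
    hF.comp (by fun_prop)
  rw [lintegral_comp_equiv_pi (symIdxEquiv q) hF, lintegral_sum_pi h1]
  refine lintegral_congr fun a => ?_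
  have h2 : Measurable fun w : Fin q ⊕ Unit → ℝ => F (Sum.elim a w ∘ (symIdxEquiv q).symm) := by
    refine h1.comp (measurable_pi_lambda _ ?_)
    rintro (i | i) <;> simp only [Sum.elim_inl, Sum.elim_inr] <;> fun_prop
  rw [lintegral_sum_pi h2]
  refine lintegral_congr fun b => lintegral_unit_pi (h2.comp (measurable_pi_lambda _ ?_))
  rintro (i | i) <;> simp only [Sum.elim_inl, Sum.elim_inr] <;> fun_prop

theorem symMatrix_glue {q : ℕ} (a : SymIdx q → ℝ) (b : Fin q → ℝ) (c : ℝ) :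
    (symMatrix (q + 1) (glue a b c)).submatrix finSumFinEquiv finSumFinEquiv
      = fromBlocks (symMatrix q a) (of fun i (_ : Fin 1) => b i)
          (of fun i (_ : Fin 1) => b i)ᵀ (of fun _ _ => c) := by
  have h1 : ∀ i j : Fin q, symMatrix (q + 1) (glue a b c) i.castSucc j.castSucc
      = symMatrix q a i j := fun i j => by
    rw [symMatrix_apply, symMatrix_apply]
    refine Eq.trans (congrArg _ ?_)
      (glue_symIdxSplit a b c (.inl ⟨(min i j, max i j), min_le_max⟩))
    simp only [symIdxSplit, Subtype.mk.injEq, Prod.mk.injEq]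
    exact ⟨(Fin.strictMono_castSucc.monotone.map_min).symm,
      (Fin.strictMono_castSucc.monotone.map_max).symm⟩
  have h2 : ∀ i : Fin q, symMatrix (q + 1) (glue a b c) i.castSucc (Fin.last q) = b i :=
    fun i => by
    rw [symMatrix_apply]
    refine Eq.trans (congrArg _ ?_) (glue_symIdxSplit a b c (.inr (.inl i)))
    simp [symIdxSplit, Fin.le_last]
  have h3 : ∀ i : Fin q, symMatrix (q + 1) (glue a b c) (Fin.last q) i.castSucc = b i :=
    fun i => by rw [← h2, ← transpose_symMatrix, transpose_apply, transpose_symMatrix]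
  have h4 : symMatrix (q + 1) (glue a b c) (Fin.last q) (Fin.last q) = c := by
    rw [symMatrix_apply]
    refine Eq.trans (congrArg _ ?_) (glue_symIdxSplit a b c (.inr (.inr ())))
    simp [symIdxSplit]
  ext (i | i) (j | j)
  · exact h1 i j
  · obtain rfl := Subsingleton.elim j 0
    exact h2 i
  · obtain rfl := Subsingleton.elim i 0
    exact h3 j
  · obtain rfl := Subsingleton.elim i 0
    obtain rfl := Subsingleton.elim j 0
    exact h4

/-- The quadratic form `bᵀ S⁻¹ b`. -/
def invQuad {q : ℕ} (S : M q q) (b : Fin q → ℝ) : ℝ :=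
  ((of fun i (_ : Fin 1) => b i)ᵀ * S⁻¹ * (of fun i (_ : Fin 1) => b i)).trace

theorem posDef_of_posDef_glue {q : ℕ} {a : SymIdx q → ℝ} {b : Fin q → ℝ} {c : ℝ}
    (h : glue a b c ∈ cone (q + 1)) : (symMatrix q a).PosDef := by
  have h1 := (posDef_of_mem_cone h).submatrix
    (finSumFinEquiv (m := q) (n := 1)).injective
  rw [symMatrix_glue] at h1
  have h2 := h1.submatrix (Sum.inl_injective (α := Fin q) (β := Fin 1))
  exact h2

/-- The second factor is the Schur complement of the leading block. -/
theorem det_symMatrix_glue {q : ℕ} {a : SymIdx q → ℝ} (b : Fin q → ℝ) (c : ℝ)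
    (ha : (symMatrix q a).PosDef) :
    (symMatrix (q + 1) (glue a b c)).det
      = (symMatrix q a).det * (c - invQuad (symMatrix q a) b) := by
  have : Invertible (symMatrix q a) := ha.isUnit.invertible
  rw [← det_submatrix_equiv_self finSumFinEquiv, symMatrix_glue, det_fromBlocks₁₁,
    invOf_eq_nonsing_inv]
  congr 1
  simp [invQuad, trace]

theorem trace_symMatrix_glue {q : ℕ} (a : SymIdx q → ℝ) (b : Fin q → ℝ) (c : ℝ) :
    (symMatrix (q + 1) (glue a b c)).trace = (symMatrix q a).trace + c := by
  have h : (symMatrix (q + 1) (glue a b c)).trace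
      = ((symMatrix (q + 1) (glue a b c)).submatrix
          (finSumFinEquiv (m := q) (n := 1)) finSumFinEquiv).trace :=
    (Equiv.sum_comp (finSumFinEquiv (m := q) (n := 1))
      (fun i => symMatrix (q + 1) (glue a b c) i i)).symm
  rw [h, symMatrix_glue]
  simp [trace]

theorem lintegral_exp_neg_invQuad {q : ℕ} {S : M q q} (hS : S.PosDef) :
    ∫⁻ b : Fin q → ℝ, ENNReal.ofReal (Real.exp (-invQuad S b))
      = ENNReal.ofReal (Real.pi ^ ((q : ℝ) / 2)) * ENNReal.ofReal (S.det ^ ((1 : ℝ) / 2)) := by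
  -- The choice V = 1/2 cancels the 1/2 in the Gaussian exponent and turns (2π)^(q/2) into π^(q/2).
  have hV : ((1 / 2 : ℝ) • (1 : M 1 1)).PosDef := PosDef.one.smul (by norm_num)
  have hVi : ((1 / 2 : ℝ) • (1 : M 1 1))⁻¹ = (2 : ℝ) • 1 :=
    inv_eq_left_inv (by rw [smul_mul_smul_comm]; norm_num)
  have h := lintegral_exp_neg_trace_inv hS hV
  rw [lintegral_vector_eq_lintegral_column]
  · have h1 : ∀ X : M q 1, -invQuad S (fun i => X i 0)
        = -(((1 / 2 : ℝ) • (1 : M 1 1))⁻¹ * Xᵀ * S⁻¹ * X).trace / 2 := by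
      intro X
      have hX : (of fun i (_ : Fin 1) => X i 0) = X := by
        ext i j
        rw [Subsingleton.elim j 0, of_apply]
      rw [invQuad, hX, hVi, Matrix.smul_mul, Matrix.smul_mul, Matrix.smul_mul, Matrix.one_mul,
        trace_smul, smul_eq_mul]
      ring
    simp_rw [h1]
    rw [h, ← ENNReal.ofReal_mul (by positivity), det_smul, det_one, Fintype.card_fin, pow_one,
      mul_one, mul_right_comm, Nat.cast_one, mul_one, ← Real.mul_rpow (by positivity) (by norm_num)]
    congr 3
    ring
  · unfold invQuad
    exact (Continuous.measurable (by fun_prop)).ennreal_ofReal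

theorem measurable_coneIntegrand {q : ℕ} (r : ℝ) (A : M q q) :
    Measurable fun S : M q q => ENNReal.ofReal
      (S.det ^ (r - ((q : ℝ) + 1) / 2) * Real.exp (-(A * S).trace)) := by
  have h : Measurable fun S : M q q => (A * S).trace := Continuous.measurable (by fun_prop)
  exact (((measurable_det q).pow_const _).mul (Real.measurable_exp.comp h.neg)).ennreal_ofReal

theorem lintegral_rpow_mul_exp_neg_ne_top {k : ℝ} (hk : -1 < k) :
    ∫⁻ t in Set.Ioi (0 : ℝ), ENNReal.ofReal (t ^ k * Real.exp (-t)) ≠ ⊤ := by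
  have h := Real.GammaIntegral_convergent (s := k + 1) (by linarith)
  have h' := h.lintegral_lt_top
  refine (lt_of_le_of_lt (le_of_eq ?_) h').ne
  refine lintegral_congr fun t => ?_
  rw [add_sub_cancel_right, mul_comm]

/-- With leading block a and Schur complement t = c - bᵀa⁻¹b, the determinant is det(a) t and the
trace is tr(a) + bᵀa⁻¹b + t. Translating c to t separates the variables; the Gaussian integral in b
contributes π^(q/2) det(a)^(1/2), which raises the exponent r - (q+2)/2 of det(a) to the r - (q+1)/2
required for size q. The inequality suffices for finiteness and needs only that a positive definite
matrix has a ∈ cone and t > 0. -/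
theorem coneIntegral_succ_le {q : ℕ} (r : ℝ) :
    coneIntegral r (1 : M (q + 1) (q + 1)) ≤
      coneIntegral r (1 : M q q) * ENNReal.ofReal (Real.pi ^ ((q : ℝ) / 2)) *
        ∫⁻ t in Set.Ioi (0 : ℝ),
          ENNReal.ofReal (t ^ (r - ((q : ℝ) + 2) / 2) * Real.exp (-t)) := by
  set k : ℝ := r - ((q : ℝ) + 2) / 2 with hk
  set H : ℝ → ENNReal :=
    (Set.Ioi (0 : ℝ)).indicator fun t => ENNReal.ofReal (t ^ k * Real.exp (-t)) with hH
  have hHm : Measurable H :=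
    Measurable.indicator (by fun_prop) measurableSet_Ioi
  set G : (SymIdx q → ℝ) → ENNReal := (cone q).indicator fun a =>
    ENNReal.ofReal ((symMatrix q a).det ^ k * Real.exp (-(symMatrix q a).trace)) with hG
  have hGt : ∀ a, G a ≠ ⊤ := fun a => by
    by_cases ha : a ∈ cone q
    · rw [hG, Set.indicator_of_mem ha]
      exact ENNReal.ofReal_ne_top
    · rw [hG, Set.indicator_of_notMem ha]
      exact ENNReal.zero_ne_top
  have hle : ∀ a b c, (cone (q + 1)).indicator (fun v => ENNReal.ofReal
        ((symMatrix (q + 1) v).det ^ (r - (((q + 1 : ℕ) : ℝ) + 1) / 2) *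
          Real.exp (-((1 : M (q + 1) (q + 1)) * symMatrix (q + 1) v).trace))) (glue a b c)
      ≤ G a * ENNReal.ofReal (Real.exp (-invQuad (symMatrix q a) b)) *
          H (c - invQuad (symMatrix q a) b) := by
    intro a b c
    by_cases hmem : glue a b c ∈ cone (q + 1)
    · have ha := posDef_of_posDef_glue hmem
      have hdet := det_symMatrix_glue b c ha
      have hpos : 0 < c - invQuad (symMatrix q a) b := by
        have := (posDef_of_mem_cone hmem).det_pos
        rw [hdet] at this
        exact (mul_pos_iff_of_pos_left ha.det_pos).1 this
      rw [Set.indicator_of_mem hmem, hG, hH, Set.indicator_of_mem (show a ∈ cone q from ha),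
        Set.indicator_of_mem (show c - invQuad (symMatrix q a) b ∈ Set.Ioi 0 from hpos),
        ← ENNReal.ofReal_mul (mul_nonneg (Real.rpow_nonneg ha.det_pos.le _) (Real.exp_nonneg _)),
        ← ENNReal.ofReal_mul (mul_nonneg (mul_nonneg (Real.rpow_nonneg ha.det_pos.le _)
          (Real.exp_nonneg _)) (Real.exp_nonneg _)), Matrix.one_mul, hdet, trace_symMatrix_glue,
        Real.mul_rpow ha.det_pos.le hpos.le]
      refine le_of_eq (congrArg _ ?_)
      have he : r - (((q + 1 : ℕ) : ℝ) + 1) / 2 = k := by rw [hk]; push_cast; ring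
      have hx : Real.exp (-((symMatrix q a).trace + c)) = Real.exp (-(symMatrix q a).trace) *
          Real.exp (-invQuad (symMatrix q a) b) *
          Real.exp (-(c - invQuad (symMatrix q a) b)) := by
        rw [← Real.exp_add, ← Real.exp_add]
        congr 1
        ring
      rw [he, hx]
      ring
    · rw [Set.indicator_of_notMem hmem]
      exact zero_le
  have hHt : ∫⁻ t in Set.Ioi (0 : ℝ), ENNReal.ofReal (t ^ k * Real.exp (-t)) = ∫⁻ t, H t :=
    (lintegral_indicator measurableSet_Ioi _).symm
  rw [hHt]
  have hE : ∀ a, Measurable fun b : Fin q → ℝ =>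
      ENNReal.ofReal (Real.exp (-invQuad (symMatrix q a) b)) := fun a => by
    unfold invQuad
    exact (Continuous.measurable (by fun_prop)).ennreal_ofReal
  calc coneIntegral r (1 : M (q + 1) (q + 1))
      ≤ ∫⁻ a, ∫⁻ b, ∫⁻ c, G a * ENNReal.ofReal (Real.exp (-invQuad (symMatrix q a) b)) *
          H (c - invQuad (symMatrix q a) b) := by
        rw [coneIntegral, ← lintegral_indicator (measurableSet_cone _), lintegral_glue]
        · exact lintegral_mono fun a => lintegral_mono fun b => lintegral_mono fun c => hle a b c
        · exact ((measurable_coneIntegrand r 1).comp (continuous_symMatrix _).measurable).indicator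
            (measurableSet_cone _)
    _ = ∫⁻ a, G a * (∫⁻ b, ENNReal.ofReal (Real.exp (-invQuad (symMatrix q a) b))) *
          ∫⁻ t, H t := by
        refine lintegral_congr fun a => ?_
        have h1 : ∀ b, ∫⁻ c, G a * ENNReal.ofReal (Real.exp (-invQuad (symMatrix q a) b)) *
            H (c - invQuad (symMatrix q a) b)
            = G a * ENNReal.ofReal (Real.exp (-invQuad (symMatrix q a) b)) * ∫⁻ t, H t := by
          intro b
          rw [lintegral_const_mul' _ _ (ENNReal.mul_ne_top (hGt a) ENNReal.ofReal_ne_top),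
            lintegral_sub_right_eq_self]
        simp_rw [h1]
        rw [lintegral_mul_const _ ((hE a).const_mul _), lintegral_const_mul' _ _ (hGt a)]
    _ = ∫⁻ a, (cone q).indicator (fun a => ENNReal.ofReal
          ((symMatrix q a).det ^ (r - ((q : ℝ) + 1) / 2) *
            Real.exp (-((1 : M q q) * symMatrix q a).trace))) a *
          (ENNReal.ofReal (Real.pi ^ ((q : ℝ) / 2)) * ∫⁻ t, H t) := by
        refine lintegral_congr fun a => ?_
        rw [← mul_assoc]
        congr 1
        by_cases ha : a ∈ cone q
        · have hS := posDef_of_mem_cone ha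
          rw [hG, Set.indicator_of_mem ha, Set.indicator_of_mem ha, lintegral_exp_neg_invQuad hS,
            Matrix.one_mul, mul_left_comm, mul_comm (ENNReal.ofReal (Real.pi ^ _)),
            ← ENNReal.ofReal_mul (mul_nonneg (Real.rpow_nonneg hS.det_pos.le _)
              (Real.exp_nonneg _)), mul_right_comm, ← Real.rpow_add hS.det_pos]
          congr 4
          rw [hk]
          ring
        · rw [hG, Set.indicator_of_notMem ha, Set.indicator_of_notMem ha, zero_mul, zero_mul]
    _ = _ := by
        rw [lintegral_mul_const, lintegral_indicator (measurableSet_cone _), ← mul_assoc]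
        · rfl
        · exact ((measurable_coneIntegrand r 1).comp (continuous_symMatrix _).measurable).indicator
            (measurableSet_cone _)

/-- In the step from q to q + 1 the hypothesis reads r > q/2, exactly the condition for
t^(r-(q+2)/2) to be integrable at 0. -/
theorem coneIntegral_one_ne_top (q : ℕ) {r : ℝ} (hr : ((q : ℝ) - 1) / 2 < r) :
    coneIntegral r (1 : M q q) ≠ ⊤ := by
  induction q with
  | zero =>
    -- For size 0 the coordinate space is a single point and the integrand is 1.
    refine ne_top_of_le_ne_top (b := ∫⁻ _ : SymIdx 0 → ℝ, 1) ?_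
      ((setLIntegral_le_lintegral _ _).trans (lintegral_mono fun v => ?_))
    · simp [volume_pi]
    · simp [trace]
  | succ q ih =>
    push_cast at hr
    refine ne_top_of_le_ne_top ?_ (coneIntegral_succ_le r)
    exact ENNReal.mul_ne_top (ENNReal.mul_ne_top (ih (by linarith)) ENNReal.ofReal_ne_top)
      (lintegral_rpow_mul_exp_neg_ne_top (by linarith))

/-! ### Positivity of the multivariate Gamma function. -/

/-- A perturbation of the identity with entries at most ε changes the quadratic form by at most ε
(∑|x i|)² ≤ ε q ∑ x i², by Cauchy–Schwarz; the radius is chosen so that ε q < 1. -/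
theorem ball_subset_cone (q : ℕ) :
    Metric.ball (symCoord q 1) (1 / ((q : ℝ) + 1)) ⊆ cone q := by
  intro v hv
  set ε : ℝ := 1 / ((q : ℝ) + 1) with hε
  have hε0 : 0 < ε := by positivity
  have hεq : ε * q < 1 := by
    rw [hε, one_div_mul_eq_div, div_lt_one (by positivity)]
    linarith
  have hH : ∀ i j, |symMatrix q v i j - (1 : M q q) i j| ≤ ε := by
    intro i j
    rw [← symMatrix_symCoord (S := (1 : M q q)) transpose_one]
    have := dist_le_pi_dist v (symCoord q 1) ⟨(min i j, max i j), min_le_max⟩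
    rw [Real.dist_eq] at this
    exact this.trans (Metric.mem_ball.1 hv).le
  refine PosDef.of_dotProduct_mulVec_pos (by
    rw [IsHermitian, conjTranspose_eq_transpose_of_trivial, transpose_symMatrix]) fun x hx => ?_
  have hx2 : 0 < ∑ i, x i ^ 2 := by
    obtain ⟨i, hi⟩ := Function.ne_iff.1 hx
    exact Finset.sum_pos' (fun _ _ => sq_nonneg _) ⟨i, Finset.mem_univ _, by
      have : x i ≠ 0 := hi
      positivity⟩
  have h1 : star x ⬝ᵥ (symMatrix q v *ᵥ x)
      = ∑ i, x i ^ 2 + ∑ i, ∑ j, (symMatrix q v i j - (1 : M q q) i j) * (x i * x j) := by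
    have e : symMatrix q v = 1 + (symMatrix q v - 1) := by abel
    conv_lhs => rw [e, add_mulVec, one_mulVec, dotProduct_add]
    congr 1
    · simp [dotProduct, sq]
    · simp only [dotProduct, mulVec, Finset.mul_sum, star_trivial, Matrix.sub_apply]
      exact Finset.sum_congr rfl fun i _ => Finset.sum_congr rfl fun j _ => by ring
  have h2 : -(ε * (∑ i, |x i|) ^ 2)
      ≤ ∑ i, ∑ j, (symMatrix q v i j - (1 : M q q) i j) * (x i * x j) := by
    rw [sq, Finset.sum_mul_sum, Finset.mul_sum, ← Finset.sum_neg_distrib]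
    refine Finset.sum_le_sum fun i _ => ?_
    rw [Finset.mul_sum, ← Finset.sum_neg_distrib]
    refine Finset.sum_le_sum fun j _ => ?_
    refine neg_le_of_abs_le ?_
    rw [abs_mul, abs_mul]
    exact mul_le_mul_of_nonneg_right (hH i j) (by positivity)
  have h3 : (∑ i, |x i|) ^ 2 ≤ q * ∑ i, x i ^ 2 := by
    have := sq_sum_le_card_mul_sum_sq (s := Finset.univ) (f := fun i => |x i|)
    simpa using this
  rw [h1]
  nlinarith [mul_le_mul_of_nonneg_left h3 hε0.le]

/-- The integrand is strictly positive on the cone, so a zero integral would make the cone null,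
although it contains a ball. -/
theorem coneIntegral_one_ne_zero (q : ℕ) (r : ℝ) : coneIntegral r (1 : M q q) ≠ 0 := by
  intro h
  have hm : Measurable fun v => ENNReal.ofReal ((symMatrix q v).det ^ (r - ((q : ℝ) + 1) / 2) *
      Real.exp (-((1 : M q q) * symMatrix q v).trace)) :=
    (measurable_coneIntegrand r 1).comp (continuous_symMatrix q).measurable
  rw [coneIntegral, lintegral_eq_zero_iff hm,
    Filter.EventuallyEq, ae_restrict_iff' (measurableSet_cone q)] at h
  have h1 : ∀ᵐ v : SymIdx q → ℝ, v ∉ cone q := by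
    filter_upwards [h] with v hv hmem
    have hp := posDef_of_mem_cone hmem
    have h0 := hv hmem
    simp only [Pi.zero_apply, ENNReal.ofReal_eq_zero] at h0
    exact absurd h0 (not_le.2 (mul_pos (Real.rpow_pos_of_pos hp.det_pos _) (Real.exp_pos _)))
  have h2 : volume (cone q) = 0 := by
    rw [ae_iff] at h1
    simpa using h1
  exact (Metric.measure_ball_pos volume (symCoord q (1 : M q q)) (by positivity)).ne'
    (measure_mono_null (ball_subset_cone q) h2)

theorem multiGamma_eq_toReal (q : ℕ) (r : ℝ) :
    multiGamma q r = (coneIntegral r (1 : M q q)).toReal := by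
  have hm := measurable_coneIntegrand r (1 : M q q)
  have hm' : Measurable fun S : M q q =>
      S.det ^ (r - ((q : ℝ) + 1) / 2) * Real.exp (-S.trace) := by
    have h : Measurable fun S : M q q => S.trace := Continuous.measurable (by fun_prop)
    exact ((measurable_det q).pow_const _).mul (Real.measurable_exp.comp h.neg)
  rw [multiGamma, integral_eq_lintegral_of_nonneg_ae _ hm'.aestronglyMeasurable,
    setLIntegral_symLeb hm'.ennreal_ofReal]
  · simp only [coneIntegral, one_mul]
  · refine (ae_restrict_iff' (measurableSet_posDefSet q)).2 (Filter.Eventually.of_forall ?_)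
    intro S hS
    exact mul_nonneg (Real.rpow_nonneg (PosDef.det_pos hS).le _) (Real.exp_nonneg _)

theorem multiGamma_pos {q : ℕ} {r : ℝ} (hr : ((q : ℝ) - 1) / 2 < r) : 0 < multiGamma q r := by
  rw [multiGamma_eq_toReal]
  exact ENNReal.toReal_pos (coneIntegral_one_ne_zero q r) (coneIntegral_one_ne_top q hr)

theorem coneIntegral_one {q : ℕ} {r : ℝ} (hr : ((q : ℝ) - 1) / 2 < r) :
    coneIntegral r (1 : M q q) = ENNReal.ofReal (multiGamma q r) := by
  rw [multiGamma_eq_toReal, ENNReal.ofReal_toReal (coneIntegral_one_ne_top q hr)]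

/-! ### Normalization of the laws; the Markov property. -/

theorem lintegral_muP {q : ℕ} {f : M q q → ENNReal} (hf : Measurable f) :
    ∫⁻ S, f S ∂(muP q) = ∫⁻ v in cone q,
      ENNReal.ofReal ((symMatrix q v).det ^ (-((q : ℝ) + 1) / 2)) * f (symMatrix q v) := by
  have hm : Measurable fun S : M q q => ENNReal.ofReal (S.det ^ (-((q : ℝ) + 1) / 2)) :=
    ((measurable_det q).pow_const _).ennreal_ofReal
  rw [muP, lintegral_withDensity_eq_lintegral_mul _ hm hf]
  exact setLIntegral_symLeb (hm.mul hf)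

theorem lintegral_cone_inv_exp_half {q : ℕ} {r : ℝ} (hr : ((q : ℝ) - 1) / 2 < r) {A : M q q}
    (hA : A.PosDef) :
    ∫⁻ v in cone q, ENNReal.ofReal ((symMatrix q v).det ^ (-r - ((q : ℝ) + 1) / 2) *
      Real.exp (-(A * (symMatrix q v)⁻¹).trace / 2))
      = ENNReal.ofReal (2 ^ (r * q) * A.det ^ (-r) * multiGamma q r) := by
  have hA2 : ((1 / 2 : ℝ) • A).PosDef := hA.smul (by norm_num)
  have htr : ∀ S : M q q, -(A * S⁻¹).trace / 2 = -(((1 / 2 : ℝ) • A) * S⁻¹).trace := by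
    intro S
    rw [Matrix.smul_mul, trace_smul, smul_eq_mul]
    ring
  simp_rw [htr]
  rw [lintegral_cone_inv_exp, coneIntegral_eq r hA2, coneIntegral_one hr,
    ← ENNReal.ofReal_mul (Real.rpow_nonneg hA2.det_pos.le _), det_smul, Fintype.card_fin,
    Real.mul_rpow (by positivity) hA.det_pos.le, one_div, inv_pow,
    Real.inv_rpow (by positivity), Real.rpow_neg (by positivity), inv_inv, ← Real.rpow_natCast,
    ← Real.rpow_mul (by norm_num), mul_comm (q : ℝ)]

theorem muP_density_mul_invWishartDensity {q : ℕ} {r : ℝ} {T S : M q q} (hS : S.PosDef) :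
    S.det ^ (-((q : ℝ) + 1) / 2) * invWishartDensity r T S
      = T.det ^ (r / 2) / (2 ^ (r * q / 2) * multiGamma q (r / 2)) *
        (S.det ^ (-(r / 2) - ((q : ℝ) + 1) / 2) * Real.exp (-(T * S⁻¹).trace / 2)) := by
  have h : S.det ^ (-(r / 2) - ((q : ℝ) + 1) / 2)
      = (S.det ^ (r / 2))⁻¹ * S.det ^ (-((q : ℝ) + 1) / 2) := by
    rw [← Real.rpow_neg hS.det_pos.le, ← Real.rpow_add hS.det_pos]
    congr 1
    ring
  rw [h, invWishartDensity]
  simp only [div_eq_mul_inv, mul_inv]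
  ring

theorem measurable_invWishartDensity_right {q : ℕ} (r : ℝ) (T : M q q) :
    Measurable fun S : M q q => invWishartDensity r T S := by
  unfold invWishartDensity
  have hc : Continuous fun S : M q q => (T * S).trace := by fun_prop
  have h := hc.measurable.comp (measurable_inv q)
  exact ((Real.measurable_exp.comp (h.neg.div_const 2)).const_mul _).div
    ((((measurable_det q).pow_const _).const_mul _).mul_const _)

theorem lintegral_invWishart {q : ℕ} (r : ℝ) (T : M q q)
    {f : M q q → ENNReal} (hf : Measurable f) :
    ∫⁻ S, f S ∂(invWishart r T) = ∫⁻ v in cone q,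
      ENNReal.ofReal (T.det ^ (r / 2) / (2 ^ (r * q / 2) * multiGamma q (r / 2)) *
        ((symMatrix q v).det ^ (-(r / 2) - ((q : ℝ) + 1) / 2) *
          Real.exp (-(T * (symMatrix q v)⁻¹).trace / 2))) * f (symMatrix q v) := by
  have hm := (measurable_invWishartDensity_right r T).ennreal_ofReal
  rw [invWishart, lintegral_withDensity_eq_lintegral_mul _ hm hf, lintegral_muP (hm.mul hf)]
  refine setLIntegral_congr_fun (measurableSet_cone q) fun v hv => ?_
  have hS := posDef_of_mem_cone hv
  rw [Pi.mul_apply, ← mul_assoc, ← ENNReal.ofReal_mul (Real.rpow_nonneg hS.det_pos.le _),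
    muP_density_mul_invWishartDensity hS]

theorem isProbabilityMeasure_invWishart {q : ℕ} {r : ℝ} (hr : (q : ℝ) - 1 < r) {T : M q q}
    (hT : T.PosDef) : IsProbabilityMeasure (invWishart r T) := by
  have hr2 : ((q : ℝ) - 1) / 2 < r / 2 := by linarith
  have hG := multiGamma_pos hr2
  have hTd := Real.rpow_pos_of_pos hT.det_pos (r / 2)
  have hc : 0 ≤ T.det ^ (r / 2) / (2 ^ (r * q / 2) * multiGamma q (r / 2)) := by positivity
  refine ⟨?_⟩
  rw [← lintegral_one, lintegral_invWishart r T measurable_const]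
  simp only [mul_one, ENNReal.ofReal_mul hc]
  rw [lintegral_const_mul' _ _ ENNReal.ofReal_ne_top, lintegral_cone_inv_exp_half hr2 hT,
    ← ENNReal.ofReal_mul hc, Real.rpow_neg hT.det_pos.le, ← ENNReal.ofReal_one]
  congr 1
  rw [div_mul_eq_mul_div r 2]
  field_simp

/-- Needed because the matrix-normal density is normalized only for positive definite V. -/
theorem ae_posDef_invWishart {q : ℕ} (r : ℝ) (T : M q q) :
    ∀ᵐ V ∂(invWishart r T), V.PosDef := by
  refine ((withDensity_absolutelyContinuous _ _).trans
    (withDensity_absolutelyContinuous _ _)).ae_le ?_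
  exact ae_restrict_mem (measurableSet_posDefSet q)

theorem isProbabilityMeasure_matrixNormal {p q : ℕ} {U : M p p} {V : M q q} (hU : U.PosDef)
    (hV : V.PosDef) : IsProbabilityMeasure (matrixNormal 0 U V) :=
  ⟨by rw [matrixNormal, withDensity_apply _ MeasurableSet.univ, Measure.restrict_univ,
    lintegral_normalDensity hU hV]⟩

theorem measurable_matrixNormal {p q : ℕ} (U : M p p) :
    Measurable fun V : M q q => (matrixNormal 0 U V : Measure (M p q)) := by
  refine Measure.measurable_of_measurable_coe _ fun s hs => ?_
  simp only [matrixNormal, withDensity_apply _ hs]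
  exact (measurable_normalDensity U).ennreal_ofReal.lintegral_prod_right'

theorem isProbabilityMeasure_noiseLaw {p q : ℕ} (hqp : q ≤ p) {U : M p p} (hU : U.PosDef)
    {x : M p q} (hx : (xᵀ * U⁻¹ * x).det ≠ 0) : IsProbabilityMeasure (noiseLaw U x) := by
  have hr : (q : ℝ) - 1 < p := by
    have : (q : ℝ) ≤ p := by exact_mod_cast hqp
    linarith
  have := isProbabilityMeasure_invWishart hr (posDef_gram hU hx)
  refine ⟨?_⟩
  rw [noiseLaw, Measure.bind_apply MeasurableSet.univ (measurable_matrixNormal U).aemeasurable]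
  have h : ∀ᵐ V ∂(invWishart (p : ℝ) (xᵀ * U⁻¹ * x)),
      (matrixNormal 0 U V : Measure (M p q)) Set.univ = 1 := by
    filter_upwards [ae_posDef_invWishart (p : ℝ) (xᵀ * U⁻¹ * x)] with V hV
    exact (isProbabilityMeasure_matrixNormal hU hV).measure_univ
  rw [lintegral_congr_ae h, lintegral_one, measure_univ]

theorem isMarkovKernel_mpcnKernel {p q : ℕ} (hqp : q ≤ p) (ρ : ℝ) {U : M p p} (hU : U.PosDef) :
    IsMarkovKernel (mpcnKernel (q := q) ρ U) := by
  refine ⟨fun x => ?_⟩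
  change IsProbabilityMeasure (ite _ _ _)
  split_ifs with hx
  · infer_instance
  · have := isProbabilityMeasure_noiseLaw hqp hU hx
    exact Measure.isProbabilityMeasure_map (Continuous.aemeasurable (by fun_prop))

/-! ### The density of the noise. -/

/-- The normalizing constant of the density of `noiseLaw`. -/
def noiseConst {p q : ℕ} (U : M p p) (x : M p q) : ℝ :=
  (xᵀ * U⁻¹ * x).det ^ ((p : ℝ) / 2) / (2 ^ ((p : ℝ) * q / 2) * multiGamma q ((p : ℝ) / 2)) *
    ((2 * Real.pi) ^ ((p : ℝ) * q / 2) * U.det ^ ((q : ℝ) / 2))⁻¹ *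
      (2 ^ ((p : ℝ) * q) * multiGamma q p)

/-- The Lebesgue density of `noiseLaw`. -/
def noiseDensity {p q : ℕ} (U : M p p) (x w : M p q) : ℝ :=
  noiseConst U x * (xᵀ * U⁻¹ * x + wᵀ * U⁻¹ * w).det ^ (-(p : ℝ))

theorem measurable_noiseDensity {p q : ℕ} (U : M p p) (x : M p q) :
    Measurable fun w => noiseDensity U x w := by
  have h : Continuous fun w : M p q => (xᵀ * U⁻¹ * x + wᵀ * U⁻¹ * w).det := by fun_prop
  exact (h.measurable.pow_const _).const_mul _

/-- Conjugacy: the two exponentials combine into the trace of (G + wᵀU⁻¹w)V⁻¹, and the normal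
density contributes a further det(V)^(-p/2). What remains is the inverse-Wishart integral with r/2
equal to p, the source of Γ_q(p). -/
theorem lintegral_cone_mul_normalDensity {p q : ℕ} (hqp : q ≤ p) {U : M p p} (hU : U.PosDef)
    {x : M p q} (hx : (xᵀ * U⁻¹ * x).det ≠ 0) (w : M p q) :
    ∫⁻ v in cone q, ENNReal.ofReal ((xᵀ * U⁻¹ * x).det ^ ((p : ℝ) / 2) /
        (2 ^ ((p : ℝ) * q / 2) * multiGamma q ((p : ℝ) / 2)) *
        ((symMatrix q v).det ^ (-((p : ℝ) / 2) - ((q : ℝ) + 1) / 2) *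
          Real.exp (-((xᵀ * U⁻¹ * x) * (symMatrix q v)⁻¹).trace / 2))) *
        ENNReal.ofReal (normalDensity 0 U (symMatrix q v) w)
      = ENNReal.ofReal (noiseDensity U x w) := by
  have hqp' : (q : ℝ) ≤ p := by exact_mod_cast hqp
  have hG := posDef_gram hU hx
  set G := xᵀ * U⁻¹ * x with hGdef
  have hA : (G + wᵀ * U⁻¹ * w).PosDef := hG.add_posSemidef (posSemidef_gram hU w)
  have h1 := multiGamma_pos (q := q) (r := (p : ℝ) / 2) (by linarith)
  have hGd := Real.rpow_pos_of_pos hG.det_pos ((p : ℝ) / 2)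
  have hUd := Real.rpow_pos_of_pos hU.det_pos ((q : ℝ) / 2)
  have hc : 0 ≤ G.det ^ ((p : ℝ) / 2) / (2 ^ ((p : ℝ) * q / 2) * multiGamma q ((p : ℝ) / 2)) *
      ((2 * Real.pi) ^ ((p : ℝ) * q / 2) * U.det ^ ((q : ℝ) / 2))⁻¹ := by positivity
  have h2 : ENNReal.ofReal (noiseDensity U x w)
      = ENNReal.ofReal (G.det ^ ((p : ℝ) / 2) /
          (2 ^ ((p : ℝ) * q / 2) * multiGamma q ((p : ℝ) / 2)) *
          ((2 * Real.pi) ^ ((p : ℝ) * q / 2) * U.det ^ ((q : ℝ) / 2))⁻¹) *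
        ENNReal.ofReal (2 ^ ((p : ℝ) * q) * (G + wᵀ * U⁻¹ * w).det ^ (-(p : ℝ)) *
          multiGamma q p) := by
    rw [← ENNReal.ofReal_mul hc, noiseDensity, noiseConst, ← hGdef]
    congr 1
    ring
  rw [h2, ← lintegral_cone_inv_exp_half (by linarith) hA,
    ← lintegral_const_mul' _ _ ENNReal.ofReal_ne_top]
  refine setLIntegral_congr_fun (measurableSet_cone q) fun v hv => ?_
  have hS := posDef_of_mem_cone hv
  have hSd := Real.rpow_pos_of_pos hS.det_pos (-((p : ℝ) / 2) - ((q : ℝ) + 1) / 2)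
  have hexp : Real.exp (-((G + wᵀ * U⁻¹ * w) * (symMatrix q v)⁻¹).trace / 2)
      = Real.exp (-(G * (symMatrix q v)⁻¹).trace / 2) *
        Real.exp (-((symMatrix q v)⁻¹ * wᵀ * U⁻¹ * w).trace / 2) := by
    rw [← Real.exp_add, Matrix.add_mul, trace_add, trace_mul_comm (wᵀ * U⁻¹ * w)]
    simp only [Matrix.mul_assoc]
    congr 1
    ring
  have hpow : (symMatrix q v).det ^ (-(p : ℝ) - ((q : ℝ) + 1) / 2)
      = (symMatrix q v).det ^ (-((p : ℝ) / 2) - ((q : ℝ) + 1) / 2) *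
        ((symMatrix q v).det ^ ((p : ℝ) / 2))⁻¹ := by
    rw [← Real.rpow_neg hS.det_pos.le, ← Real.rpow_add hS.det_pos]
    congr 1
    ring
  simp only [normalDensity, sub_zero]
  rw [← ENNReal.ofReal_mul (by positivity), ← ENNReal.ofReal_mul hc, hexp, hpow]
  congr 1
  simp only [div_eq_mul_inv, mul_inv]
  ring

theorem noiseLaw_eq_withDensity {p q : ℕ} (hqp : q ≤ p) {U : M p p} (hU : U.PosDef)
    {x : M p q} (hx : (xᵀ * U⁻¹ * x).det ≠ 0) :
    noiseLaw U x = (volume : Measure (M p q)).withDensity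
      fun w => ENNReal.ofReal (noiseDensity U x w) := by
  ext B hB
  have hm : Measurable fun V : M q q => (matrixNormal 0 U V : Measure (M p q)) B :=
    (Measure.measurable_coe hB).comp (measurable_matrixNormal U)
  rw [noiseLaw, Measure.bind_apply hB (measurable_matrixNormal U).aemeasurable,
    lintegral_invWishart _ _ hm, withDensity_apply _ hB]
  have hs := (continuous_symMatrix q).measurable
  have h1 : Measurable fun S : M q q => ((xᵀ * U⁻¹ * x) * S).trace :=
    Continuous.measurable (by fun_prop)
  have h2 : Measurable fun v => ((xᵀ * U⁻¹ * x) * (symMatrix q v)⁻¹).trace :=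
    h1.comp ((measurable_inv q).comp hs)
  have h3 : Measurable fun v => (symMatrix q v).det := (measurable_det q).comp hs
  have h4 : Measurable fun z : (SymIdx q → ℝ) × M p q =>
      normalDensity 0 U (symMatrix q z.1) z.2 := by
    have h : Measurable fun z : (SymIdx q → ℝ) × M p q => (symMatrix q z.1, z.2) :=
      (hs.comp measurable_fst).prodMk measurable_snd
    simpa only [Function.comp_def] using (measurable_normalDensity (q := q) U).comp h
  have h5 := (((h3.pow_const (-((p : ℝ) / 2) - ((q : ℝ) + 1) / 2)).mul
    (Real.measurable_exp.comp (h2.neg.div_const 2))).const_mul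
      ((xᵀ * U⁻¹ * x).det ^ ((p : ℝ) / 2) /
        (2 ^ ((p : ℝ) * q / 2) * multiGamma q ((p : ℝ) / 2)))).ennreal_ofReal
  calc _ = ∫⁻ v in cone q, ∫⁻ w in B, ENNReal.ofReal ((xᵀ * U⁻¹ * x).det ^ ((p : ℝ) / 2) /
        (2 ^ ((p : ℝ) * q / 2) * multiGamma q ((p : ℝ) / 2)) *
        ((symMatrix q v).det ^ (-((p : ℝ) / 2) - ((q : ℝ) + 1) / 2) *
          Real.exp (-((xᵀ * U⁻¹ * x) * (symMatrix q v)⁻¹).trace / 2))) *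
        ENNReal.ofReal (normalDensity 0 U (symMatrix q v) w) :=
      lintegral_congr fun v => by
        rw [matrixNormal, withDensity_apply _ hB, lintegral_const_mul' _ _ ENNReal.ofReal_ne_top]
    _ = ∫⁻ w in B, ∫⁻ v in cone q, ENNReal.ofReal ((xᵀ * U⁻¹ * x).det ^ ((p : ℝ) / 2) /
        (2 ^ ((p : ℝ) * q / 2) * multiGamma q ((p : ℝ) / 2)) *
        ((symMatrix q v).det ^ (-((p : ℝ) / 2) - ((q : ℝ) + 1) / 2) *
          Real.exp (-((xᵀ * U⁻¹ * x) * (symMatrix q v)⁻¹).trace / 2))) *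
        ENNReal.ofReal (normalDensity 0 U (symMatrix q v) w) :=
      lintegral_lintegral_swap ((h5.comp measurable_fst).mul h4.ennreal_ofReal).aemeasurable
    _ = _ := lintegral_congr fun w => lintegral_cone_mul_normalDensity hqp hU hx w

/-! ### From the noise to the proposal density. -/

theorem lintegral_affine {p q : ℕ} (a : M p q) {b : ℝ} (hb : 0 < b) {g : M p q → ENNReal}
    (hg : Measurable g) :
    ∫⁻ y, g y = ENNReal.ofReal (b ^ (p * q)) * ∫⁻ w, g (a + b • w) := by
  have hfr : Module.finrank ℝ (Fin p → Fin q → ℝ) = p * q := by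
    simp [Module.finrank_pi_fintype]
  have hdet : LinearMap.det (b • (LinearMap.id : (Fin p → Fin q → ℝ) →ₗ[ℝ] _)) = b ^ (p * q) := by
    rw [LinearMap.det_smul, LinearMap.det_id, mul_one, hfr]
  have h1 := lintegral_add_left_eq_self (μ := (volume : Measure (Fin p → Fin q → ℝ)))
    (fun y => g (of y)) (fun i j => a i j)
  have hg' : Measurable fun y : Fin p → Fin q → ℝ => g (a + of y) :=
    hg.comp (Continuous.measurable (by fun_prop))
  have h2 := lintegral_eq_det_mul_lintegral_comp (volume : Measure (Fin p → Fin q → ℝ))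
    (f := b • LinearMap.id) (by rw [hdet]; positivity) hg'
  rw [hdet, abs_of_pos (by positivity)] at h2
  exact h1.symm.trans h2

theorem map_affine_withDensity {p q : ℕ} (a : M p q) {b : ℝ} (hb : 0 < b) {g : M p q → ℝ}
    (hg : Measurable g) :
    ((volume : Measure (M p q)).withDensity fun w => ENNReal.ofReal (g w)).map
        (fun w => a + b • w)
      = (volume : Measure (M p q)).withDensity
        fun y => ENNReal.ofReal ((b ^ (p * q))⁻¹ * g (b⁻¹ • (y - a))) := by
  have hf : Measurable fun w : M p q => a + b • w := Continuous.measurable (by fun_prop)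
  have hs : Measurable fun y : M p q => b⁻¹ • (y - a) := Continuous.measurable (by fun_prop)
  have hm : Measurable fun y : M p q =>
      ENNReal.ofReal ((b ^ (p * q))⁻¹ * g (b⁻¹ • (y - a))) :=
    ((hg.comp hs).const_mul _).ennreal_ofReal
  have hbp : 0 < b ^ (p * q) := by positivity
  ext B hB
  rw [Measure.map_apply hf hB, withDensity_apply _ (hf hB), withDensity_apply _ hB,
    ← lintegral_indicator hB, ← lintegral_indicator (hf hB),
    lintegral_affine a hb (hm.indicator hB), ← lintegral_const_mul' _ _ ENNReal.ofReal_ne_top]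
  refine lintegral_congr fun w => ?_
  by_cases hw : a + b • w ∈ B
  · rw [Set.indicator_of_mem (show w ∈ (fun w => a + b • w) ⁻¹' B from hw),
      Set.indicator_of_mem hw, ← ENNReal.ofReal_mul hbp.le, ← mul_assoc,
      mul_inv_cancel₀ hbp.ne', one_mul, add_sub_cancel_left, smul_smul, inv_mul_cancel₀ hb.ne',
      one_smul]
  · rw [Set.indicator_of_notMem (show w ∉ (fun w => a + b • w) ⁻¹' B from hw),
      Set.indicator_of_notMem hw, mul_zero]

/-- After multiplication by 1 - ρ, the term -ρ xᵀU⁻¹x cancels the ρ xᵀU⁻¹x from expanding the square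
of y - ρ^(1/2) x. This cancellation is what makes the result symmetric. -/
theorem gram_add_gram_eq_smul_R {p q : ℕ} {ρ : ℝ} (hρ0 : 0 ≤ ρ) (hρ1 : ρ < 1) (U : M p p)
    (x y : M p q) :
    xᵀ * U⁻¹ * x +
        ((√(1 - ρ))⁻¹ • (y - √ρ • x))ᵀ * U⁻¹ * ((√(1 - ρ))⁻¹ • (y - √ρ • x))
      = (1 - ρ)⁻¹ • R ρ U x y := by
  have hs : 0 < 1 - ρ := by linarith
  have h1 : (√(1 - ρ))⁻¹ * (√(1 - ρ))⁻¹ = (1 - ρ)⁻¹ := by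
    rw [← mul_inv, Real.mul_self_sqrt hs.le]
  have h2 : xᵀ * U⁻¹ * x = (1 - ρ)⁻¹ • ((1 - ρ) • (xᵀ * U⁻¹ * x)) := by
    rw [smul_smul, inv_mul_cancel₀ hs.ne', one_smul]
  rw [transpose_smul, Matrix.smul_mul, Matrix.smul_mul, Matrix.mul_smul, smul_smul, h1,
    h2, ← smul_add]
  congr 1
  rw [R, transpose_sub, transpose_smul, Matrix.sub_mul, Matrix.sub_mul, Matrix.mul_sub,
    Matrix.mul_sub]
  simp only [Matrix.smul_mul, Matrix.mul_smul, smul_smul, Real.mul_self_sqrt hρ0, sub_smul, one_smul]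
  abel

/-- Bookkeeping of constants: the Jacobian gives (1-ρ)^(-pq/2) and det((1-ρ)⁻¹R)^(-p) gives
(1-ρ)^(pq), leaving (1-ρ)^(pq/2); the powers of 2 cancel; π, det(U) and one factor Γ_q(p/2) are
absorbed by ν_U. -/
theorem mul_noiseDensity_eq {p q : ℕ} (hqp : q ≤ p) {ρ : ℝ} (hρ0 : 0 ≤ ρ) (hρ1 : ρ < 1)
    {U : M p p} (hU : U.PosDef) {x y : M p q} (hx : (xᵀ * U⁻¹ * x).det ≠ 0)
    (hy : (yᵀ * U⁻¹ * y).det ≠ 0) :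
    (√(1 - ρ) ^ (p * q))⁻¹ * noiseDensity U x ((√(1 - ρ))⁻¹ • (y - √ρ • x))
      = nuDensity U y * density ρ U x y := by
  have hqp' : (q : ℝ) ≤ p := by exact_mod_cast hqp
  have hs : 0 < 1 - ρ := by linarith
  have hG := posDef_gram hU hx
  have hW := posDef_gram hU hy
  -- Positivity of det R is read off from this matrix, a positive multiple of R.
  have hA : (xᵀ * U⁻¹ * x + ((√(1 - ρ))⁻¹ • (y - √ρ • x))ᵀ * U⁻¹ *
      ((√(1 - ρ))⁻¹ • (y - √ρ • x))).PosDef := hG.add_posSemidef (posSemidef_gram hU _)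
  have hdet := hA.det_pos
  rw [gram_add_gram_eq_smul_R hρ0 hρ1, det_smul, Fintype.card_fin] at hdet
  have hR : 0 < (R ρ U x y).det := (mul_pos_iff_of_pos_left (by positivity)).1 hdet
  have hΓ := multiGamma_pos (q := q) (r := (p : ℝ) / 2) (by linarith)
  have hUd := Real.rpow_pos_of_pos hU.det_pos ((q : ℝ) / 2)
  have hWd := Real.rpow_pos_of_pos hW.det_pos ((p : ℝ) / 2)
  have hα : √(1 - ρ) ^ (p * q) = (1 - ρ) ^ ((p : ℝ) * q / 2) := by
    rw [Real.sqrt_eq_rpow, ← Real.rpow_natCast, ← Real.rpow_mul hs.le]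
    congr 1
    push_cast
    ring
  have hα0 : 0 < (1 - ρ) ^ ((p : ℝ) * q / 2) := Real.rpow_pos_of_pos hs _
  have hα2 : ((1 - ρ)⁻¹ ^ q * (R ρ U x y).det) ^ (-(p : ℝ))
      = ((1 - ρ) ^ ((p : ℝ) * q / 2)) ^ 2 / (R ρ U x y).det ^ p := by
    rw [Real.rpow_neg hdet.le, Real.rpow_natCast, mul_pow, mul_inv, inv_pow, inv_pow, inv_inv,
      ← Real.rpow_mul_natCast hs.le, ← pow_mul, div_eq_mul_inv]
    congr 1
    rw [← Real.rpow_natCast]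
    congr 1
    push_cast
    ring
  have hβ2 : (2 : ℝ) ^ ((p : ℝ) * q) = (2 ^ ((p : ℝ) * q / 2)) ^ 2 := by
    rw [← Real.rpow_mul_natCast (by norm_num)]
    congr 1
    push_cast
    ring
  have hβ0 : (0 : ℝ) < 2 ^ ((p : ℝ) * q / 2) := by positivity
  have hπ0 : 0 < Real.pi ^ ((p : ℝ) * q / 2) := by positivity
  rw [noiseDensity, noiseConst, gram_add_gram_eq_smul_R hρ0 hρ1, det_smul, Fintype.card_fin, hα2,
    hβ2, hα, Real.mul_rpow (by norm_num) Real.pi_pos.le, nuDensity, density, c, neg_div,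
    Real.rpow_neg hU.det_pos.le]
  field_simp

/-! ### The density with respect to ν_U and reversibility. -/

theorem measurable_density {p q : ℕ} (ρ : ℝ) (U : M p p) :
    Measurable fun z : M p q × M p q => density ρ U z.1 z.2 := by
  have h1 : Measurable fun x : M p q => (xᵀ * U⁻¹ * x).det :=
    (measurable_det q).comp (measurable_gram U)
  have h2 : Continuous fun z : M p q × M p q => (R ρ U z.1 z.2).det := by
    unfold R
    fun_prop
  exact ((((h1.comp measurable_fst).pow_const _).mul
    ((h1.comp measurable_snd).pow_const _)).div (h2.measurable.pow_const _)).const_mul _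

theorem measurable_nuDensity {p q : ℕ} (U : M p p) :
    Measurable fun x : M p q => nuDensity U x := by
  have h1 : Measurable fun x : M p q => (xᵀ * U⁻¹ * x).det :=
    (measurable_det q).comp (measurable_gram U)
  exact ((h1.pow_const _).const_div _).const_mul _

/-- Exchanging x and y permutes the terms of R. No nonsingularity is needed, since division by zero
gives 0 on both sides. -/
theorem density_comm {p q : ℕ} (ρ : ℝ) (U : M p p) (x y : M p q) :
    density ρ U x y = density ρ U y x := by
  have h : R ρ U x y = R ρ U y x := by
    unfold R
    abel
  rw [density, density, h, mul_comm ((xᵀ * U⁻¹ * x).det ^ _)]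

theorem mpcnKernel_eq_withDensity {p q : ℕ} (hqp : q ≤ p) {ρ : ℝ} (hρ0 : 0 ≤ ρ) (hρ1 : ρ < 1)
    {U : M p p} (hU : U.PosDef) {x : M p q} (hx : (xᵀ * U⁻¹ * x).det ≠ 0) :
    mpcnKernel ρ U x
      = (nu q U).withDensity fun y => ENNReal.ofReal (density ρ U x y) := by
  have hqp' : (q : ℝ) ≤ p := by exact_mod_cast hqp
  have hm : Measurable fun y => density ρ U x y := by
    simpa only [Function.comp_def] using (measurable_density ρ U).comp measurable_prodMk_left
  have h1 : mpcnKernel ρ U x = proposalLaw ρ U x := if_neg hx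
  rw [h1, proposalLaw, noiseLaw_eq_withDensity hqp hU hx,
    map_affine_withDensity _ (Real.sqrt_pos.2 (by linarith)) (measurable_noiseDensity U x), nu,
    ← withDensity_mul _ (measurable_nuDensity U).ennreal_ofReal
      hm.ennreal_ofReal]
  -- The pointwise identity needs yᵀU⁻¹y nonsingular, which holds for almost every y.
  refine withDensity_congr_ae ?_
  filter_upwards [ae_det_gram_ne_zero hqp hU] with y hy
  have hν : 0 ≤ nuDensity U y := by
    have := multiGamma_pos (q := q) (r := (p : ℝ) / 2) (by linarith)
    have := Real.rpow_pos_of_pos hU.det_pos (-(q : ℝ) / 2)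
    have := Real.rpow_pos_of_pos (posDef_gram hU hy).det_pos ((p : ℝ) / 2)
    unfold nuDensity
    positivity
  rw [Pi.mul_apply, ← ENNReal.ofReal_mul hν, mul_noiseDensity_eq hqp hρ0 hρ1 hU hx hy]

/-- ν_U is absolutely continuous, so it ignores the points where the kernel is a Dirac mass.
Elsewhere both sides are double integrals of one symmetric density against ν_U ⊗ ν_U, and Tonelli
exchanges them. -/
theorem isReversible_mpcnKernel {p q : ℕ} (hqp : q ≤ p) {ρ : ℝ} (hρ0 : 0 ≤ ρ) (hρ1 : ρ < 1)
    {U : M p p} (hU : U.PosDef) :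
    (mpcnKernel (q := q) ρ U).IsReversible (nu q U) := by
  have hae : ∀ᵐ x ∂(nu q U), (xᵀ * U⁻¹ * x).det ≠ 0 :=
    (withDensity_absolutelyContinuous _ _).ae_le (ae_det_gram_ne_zero hqp hU)
  have hsf : SFinite (nu q U) := by
    unfold nu
    infer_instance
  have key : ∀ A B : Set (M p q), MeasurableSet B →
      ∫⁻ x in A, mpcnKernel ρ U x B ∂(nu q U)
        = ∫⁻ x in A, ∫⁻ y in B, ENNReal.ofReal (density ρ U x y) ∂(nu q U) ∂(nu q U) := by
    intro A B hB
    refine lintegral_congr_ae (ae_restrict_of_ae ?_)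
    filter_upwards [hae] with x hx
    rw [mpcnKernel_eq_withDensity hqp hρ0 hρ1 hU hx, withDensity_apply _ hB]
  intro A B hA hB
  rw [key A B hB, key B A hA,
    lintegral_lintegral_swap (measurable_density ρ U).ennreal_ofReal.aemeasurable]
  simp_rw [density_comm ρ U]

end MpCN

end

theorem mainTheorem4 (p q : ℕ) (hq : 1 ≤ q) (hqp : q ≤ p) (ρ : ℝ) (hρ0 : 0 ≤ ρ) (hρ1 : ρ < 1)
    (U : MpCN.M p p) (hU : U.PosDef) :
    IsMarkovKernel (MpCN.mpcnKernel (q := q) ρ U) ∧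
    (∀ x : MpCN.M p q, (xᵀ * U⁻¹ * x).det ≠ 0 →
      MpCN.mpcnKernel ρ U x =
        (MpCN.nu q U).withDensity (fun y => ENNReal.ofReal (MpCN.density ρ U x y))) ∧
    (∀ x y : MpCN.M p q, MpCN.density ρ U x y = MpCN.density ρ U y x) ∧
    (MpCN.mpcnKernel (q := q) ρ U).IsReversible (MpCN.nu q U) :=
  ⟨MpCN.isMarkovKernel_mpcnKernel hqp ρ hU,
    fun _ hx => MpCN.mpcnKernel_eq_withDensity hqp hρ0 hρ1 hU hx, MpCN.density_comm ρ U,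
    MpCN.isReversible_mpcnKernel hqp hρ0 hρ1 hU⟩
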